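/- Let $G$ be the fundamental group of a graph of groups over a nonempty connected graph (possibly infinite, loops and multiple edges allowed), taken with respect to a spanning tree; that is, $G$ is generated by the vertex groups and a stable letter $t_e$ for each edge $e$ (with a chosen orientation), subject to the relations of the vertex groups, $t_e\,\tau_e(x)\,t_e^{-1}=\sigma_e(x)$ for all $x$ in the edge group of $e$ (where $\sigma_e,\tau_e$ are the injections into the vertex groups at the origin and terminus of $e$), and $t_e=1$ for $e$ in the tree. Suppose that the image $C\le G$ of every edge group is malnormal in $G$, i.e. $gCg^{-1}\cap C=\{1\}$ for every $g\in G\setminus C$. Then for every integral chain $c$ (a finite formal sum of elements of $G$ with integer coefficients), either $c$ is equivalent to an integral chain each of whose terms lies in a vertex group, or $$\mathrm{scl}_G(c)\ge \frac1{36}.$$ Here two chains are equivalent if they differ by an element of the real subspace of $C_1(G)$ (the real vector space with basis $G$) spanned by all $g^n-n\cdot g$ ($g\in G$, $n\in\mathbb Z$), all $hgh^{-1}-g$ ($g,h\in G$), and all $gh-g-h$ with $g,h\in G$ commuting. The stable commutator length is $$\mathrm{scl}_G(c)=\inf_S \frac{-\chi^-(S)}{2n(S)}\in[0,\infty],$$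 where $S$ runs over the admissible surfaces for $c$: compact oriented surfaces with a map to a space with fundamental group $G$ whose boundary factors through the loops representing the terms of $c$ and represents $n(S)\cdot c$ with $n(S)\ge 1$; $\chi^-$ is the Euler characteristic after removing disk and sphere components; and $\mathrm{scl}_G(c)=+\infty$ if there is no admissible surface, i.e. if $c$ is not null-homologous over $\mathbb Q$. -/

import Mathlib

universe u₁ u₂ u₃ u₄

set_option linter.checkUnivs false
/-- A graph of groups. Every geometric edge is listed once, with a chosen orientation from `src e`
to `tgt e`; its edge group is embedded in the vertex groups at both ends. Loops and multiple edges
are allowed, and the graph may be infinite. -/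
structure GraphOfGroups (V : Type u₁) (E : Type u₂) where
  src : E → V
  tgt : E → V
  vertexGroup : V → Type u₃
  edgeGroup : E → Type u₄
  [groupVertex : ∀ v, Group (vertexGroup v)]
  [groupEdge : ∀ e, Group (edgeGroup e)]
  srcHom : ∀ e, edgeGroup e →* vertexGroup (src e)
  tgtHom : ∀ e, edgeGroup e →* vertexGroup (tgt e)
  srcHom_injective : ∀ e, Function.Injective (srcHom e)
  tgtHom_injective : ∀ e, Function.Injective (tgtHom e)

attribute [instance] GraphOfGroups.groupVertex GraphOfGroups.groupEdge

namespace GraphOfGroups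

variable {V : Type u₁} {E : Type u₂} (𝒢 : GraphOfGroups.{u₁, u₂, u₃, u₄} V E)

/-- `T` is (the edge set of) a spanning tree of the underlying graph: its edges are not loops, no
two of them have the same pair of ends, and the simple graph they form on the set of all vertices
is a tree. A spanning tree exists exactly if the underlying graph is nonempty and connected. -/
structure IsSpanningTree (T : Set E) : Prop where
  src_ne_tgt : ∀ e ∈ T, 𝒢.src e ≠ 𝒢.tgt e
  injOn : Set.InjOn (fun e => s(𝒢.src e, 𝒢.tgt e)) T
  isTree : (SimpleGraph.fromEdgeSet ((fun e => s(𝒢.src e, 𝒢.tgt e)) '' T)).IsTree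

/-- The free product of all vertex groups and of the free group on the edges (stable letters). -/
abbrev FreeProd : Type (max u₁ u₂ u₃) :=
  Monoid.Coprod (Monoid.CoprodI 𝒢.vertexGroup) (FreeGroup E)

/-- An element of a vertex group, in the free product. -/
def freeVertexHom (v : V) : 𝒢.vertexGroup v →* 𝒢.FreeProd :=
  Monoid.Coprod.inl.comp Monoid.CoprodI.of

/-- The stable letter of an edge, in the free product. -/
def freeStableLetter (e : E) : 𝒢.FreeProd :=
  Monoid.Coprod.inr (FreeGroup.of e)

/-- The defining relators of the fundamental group with respect to a spanning tree `T`: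
`t_e * tgtHom e c * t_e⁻¹ = srcHom e c` for every edge `e` and `c` in its edge group,
and `t_e = 1` for `e ∈ T`. -/
def relators (T : Set E) : Set 𝒢.FreeProd :=
  {x | ∃ (e : E) (c : 𝒢.edgeGroup e),
      x = 𝒢.freeStableLetter e * 𝒢.freeVertexHom (𝒢.tgt e) (𝒢.tgtHom e c) *
        (𝒢.freeStableLetter e)⁻¹ * (𝒢.freeVertexHom (𝒢.src e) (𝒢.srcHom e c))⁻¹} ∪
  {x | ∃ e ∈ T, x = 𝒢.freeStableLetter e}

/-- The fundamental group of a graph of groups with respect to a spanning tree `T`. -/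
abbrev FundamentalGroup (T : Set E) : Type (max u₁ u₂ u₃) :=
  𝒢.FreeProd ⧸ Subgroup.normalClosure (𝒢.relators T)

/-- The canonical map of a vertex group to the fundamental group. -/
def vertexHom (T : Set E) (v : V) : 𝒢.vertexGroup v →* 𝒢.FundamentalGroup T :=
  (QuotientGroup.mk' (Subgroup.normalClosure (𝒢.relators T))).comp (𝒢.freeVertexHom v)

/-- The vertex group at `v` as a subgroup of the fundamental group. -/
def vertexSubgroup (T : Set E) (v : V) : Subgroup (𝒢.FundamentalGroup T) :=
  (𝒢.vertexHom T v).range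

/-- The edge group of `e` as a subgroup of the fundamental group, through the vertex group at the
terminus of `e`. (The embedding through the origin is conjugate to it by the stable letter.) -/
def edgeSubgroup (T : Set E) (e : E) : Subgroup (𝒢.FundamentalGroup T) :=
  ((𝒢.vertexHom T (𝒢.tgt e)).comp (𝒢.tgtHom e)).range

end GraphOfGroups

/-- `H` is malnormal: `g H g⁻¹ ∩ H` is trivial for every `g` outside `H`. -/
def Subgroup.IsMalnormal {G : Type*} [Group G] (H : Subgroup G) : Prop :=
  ∀ g : G, g ∉ H → ∀ h ∈ H, g * h * g⁻¹ ∈ H → h = 1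

namespace StableCommutatorLength

variable (G : Type*) [Group G]

/-- Integral chains: finite formal sums of elements of `G` with integer coefficients. -/
abbrev IntegralChain : Type _ := G →₀ ℤ

/-- The real vector space `C₁(G)` of real chains, with basis `G`. -/
abbrev RealChain : Type _ := G →₀ ℝ

/-- The subspace `E(G)` of `C₁(G)` spanned by the chains `g ^ n - n • g` (`n` an integer),
`h g h⁻¹ - g`, and `g h - g - h` for commuting `g` and `h`. -/
noncomputable def equivSubspace : Submodule ℝ (RealChain G) :=
  Submodule.span ℝ
    ({x | ∃ (g : G) (n : ℤ), x = Finsupp.single (g ^ n) 1 - (n : ℝ) • Finsupp.single g 1} ∪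
     {x | ∃ g h : G, x = Finsupp.single (h * g * h⁻¹) 1 - Finsupp.single g 1} ∪
     {x | ∃ g h : G, Commute g h ∧
        x = Finsupp.single (g * h) 1 - Finsupp.single g 1 - Finsupp.single h 1})

/-- A connected compact oriented surface of genus `genus` with `numBoundary` boundary components,
together with the homotopy class of a map `f` to a space `X` with fundamental group `G`, whose
`j`-th boundary component (with the induced orientation) factors through a map of degree
`degree j` to the circle of a loop in the free homotopy class of `loop j`.

The surface has the fundamental group generated by `a i`, `b i` and boundary classes `z j` with the
single relation `∏ (a i * b i * (a i)⁻¹ * (b i)⁻¹) * ∏ z j = 1`; so such a map amounts to elements `a i`, `b i` and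
`z j = conj j * loop j ^ degree j * (conj j)⁻¹` of `G` that satisfy it. -/
structure SurfaceComponent where
  genus : ℕ
  numBoundary : ℕ
  a : Fin genus → G
  b : Fin genus → G
  loop : Fin numBoundary → G
  degree : Fin numBoundary → ℤ
  conj : Fin numBoundary → G
  relation : (List.ofFn fun i => a i * b i * (a i)⁻¹ * (b i)⁻¹).prod *
    (List.ofFn fun j => conj j * loop j ^ degree j * (conj j)⁻¹).prod = 1

variable {G}

/-- Two real chains are equivalent if they differ by an element of `E(G)`. -/
def Equivalent (c c' : RealChain G) : Prop := c - c' ∈ equivSubspace G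

/-- An integral chain as a real chain. -/
noncomputable def IntegralChain.toReal (c : IntegralChain G) : RealChain G :=
  c.mapRange (fun n : ℤ => (n : ℝ)) Int.cast_zero

/-- The contribution of a component to `-χ⁻`: it is `-χ = 2 * genus + numBoundary - 2`, except
that spheres and disks count `0`, which is what the truncated subtraction gives. -/
def SurfaceComponent.negChi (S : SurfaceComponent G) : ℕ := 2 * S.genus + S.numBoundary - 2

open scoped Classical in
/-- The total degree with which the boundary of a component covers the loop of `g`. -/
noncomputable def SurfaceComponent.degreeOver (S : SurfaceComponent G) (g : G) : ℤ :=
  ∑ j : Fin S.numBoundary, if S.loop j = g then S.degree j else 0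

/-- The surface with components `S` is admissible of degree `n` for the integral chain `c`: `n` is
positive, every boundary component covers the loop of an element of the support of `c`, and the
boundary represents `n • c`. -/
def IsAdmissible (c : IntegralChain G) (S : List (SurfaceComponent G)) (n : ℕ) : Prop :=
  0 < n ∧ (∀ s ∈ S, ∀ j, s.loop j ∈ c.support) ∧
    ∀ g : G, (S.map fun s => s.degreeOver g).sum = n * c g

open scoped ENNReal in
/-- The stable commutator length of an integral chain: the infimum of `-χ⁻(S) / (2 n)` over all
admissible surfaces `S` of degree `n`. It is `∞` if there are none, that is, if the chain is
not null-homologous over the rationals. -/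
noncomputable def scl (c : IntegralChain G) : ℝ≥0∞ :=
  ⨅ (S : List (SurfaceComponent G)) (n : ℕ) (_ : IsAdmissible c S n),
    (((S.map SurfaceComponent.negChi).sum : ℕ) : ℝ≥0∞) / (2 * (n : ℝ≥0∞))

end StableCommutatorLength

/-!
The lower bound for `scl` is the easy half of Bavard duality: a homogeneous quasimorphism `f` of
defect `D` has `|f c| / (2 D) ≤ scl c` (`IsHomogeneousQuasimorphism.ofReal_le_scl`), so a
quasimorphism of defect `6` with `|f c| ≥ 1 / 3` suffices.

Such quasimorphisms come from the action of the group on its Bass–Serre tree. For a directed segment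
from `u` to `v`, count the translates of it that fit disjointly on the geodesic from a base vertex
`y` to `g • y`, and subtract the count for the reversed segment. Cutting the three sides of a tripod
at its median shows that the defect is at most `3`. The homogenization has at most twice the defect
(`isHomogeneousQuasimorphism_of_tendsto`), because `(a b) ^ (2 m + 1)` differs from
`a ^ (m + 1) b ^ (2 m + 1) a ^ m` by only `m` commutators.

Among the integral chains equivalent to the given one, take one whose total translation length is
least. If it is zero, all terms fix vertices of the tree, so they are conjugate into vertex groups.
Otherwise let `g` be a term with greatest translation length, and count copies of three successive
periods of its axis. The quasimorphism takes the value `1 / 3` at `g`. The axes of the other terms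
`w`, in either direction, contain no copy: along such a copy the commutator of `w` with a conjugate
of `g` (their quotient, if the translation lengths agree) fixes an edge together with a different
translate of it, so it is trivial by malnormality (`commute_of_overlap`), and then one step of
Euclid's algorithm replaces `g` by `w` and a shorter element, against minimality
(`exists_equivalent_sum_lt_of_commute`). So the quasimorphism vanishes at these `w`, and its value
at the chain is a third of the coefficient of `g`. A reversed copy on the axis of `g` itself would
make `g` conjugate to its inverse, so that `g` could be dropped.

The Bass–Serre graph is built from cosets of the images of the vertex and edge groups. That it is a
tree does not need normal forms: the universal property of the fundamental group gives a crossed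
homomorphism, hence a function on the vertices whose increment along each edge is the indicator of
that edge (`GraphOfGroups.exists_tree_potential`), and so every edge is a bridge.
-/

open Filter Topology

/-! ### Homogeneous quasimorphisms and the lower bound for `scl` -/

namespace StableCommutatorLength

variable {G : Type*} [Group G]

/-- `f` is a homogeneous quasimorphism whose defect is at most `D`. -/
structure IsHomogeneousQuasimorphism (f : G → ℝ) (D : ℝ) : Prop where
  abs_map_mul_sub_le : ∀ a b, |f (a * b) - f a - f b| ≤ D
  map_pow : ∀ a (n : ℕ), f (a ^ n) = n * f a

theorem eq_zero_of_forall_nat_mul_abs_le {x C : ℝ} (h : ∀ n : ℕ, n * |x| ≤ C) : x = 0 := by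
  by_contra hx
  obtain ⟨n, hn⟩ := exists_nat_gt (C / |x|)
  have hx' : 0 < |x| := abs_pos.mpr hx
  rw [div_lt_iff₀ hx'] at hn
  exact absurd (h n) (not_le.mpr hn)

namespace IsHomogeneousQuasimorphism

variable {f : G → ℝ} {D : ℝ}

theorem map_one (hf : IsHomogeneousQuasimorphism f D) : f 1 = 0 := by
  simpa using hf.map_pow 1 0

theorem defect_nonneg (hf : IsHomogeneousQuasimorphism f D) : 0 ≤ D :=
  (abs_nonneg _).trans (hf.abs_map_mul_sub_le 1 1)

theorem map_mul_of_commute (hf : IsHomogeneousQuasimorphism f D) {a b : G} (h : Commute a b) :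
    f (a * b) = f a + f b := by
  have : f (a * b) - f a - f b = 0 := by
    refine eq_zero_of_forall_nat_mul_abs_le (C := D) fun n => ?_
    have h1 := hf.abs_map_mul_sub_le (a ^ n) (b ^ n)
    rw [← h.mul_pow, hf.map_pow, hf.map_pow, hf.map_pow, ← mul_sub, ← mul_sub, abs_mul,
      Nat.abs_cast] at h1
    exact h1
  linarith

theorem map_inv (hf : IsHomogeneousQuasimorphism f D) (a : G) : f a⁻¹ = -f a := by
  have := hf.map_mul_of_commute (Commute.refl a).inv_right
  rw [mul_inv_cancel, hf.map_one] at this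
  linarith

theorem map_zpow (hf : IsHomogeneousQuasimorphism f D) (a : G) (n : ℤ) : f (a ^ n) = n * f a := by
  obtain ⟨m, rfl | rfl⟩ := n.eq_nat_or_neg
  · simp [hf.map_pow]
  · simp [hf.map_pow, hf.map_inv]

theorem map_conj (hf : IsHomogeneousQuasimorphism f D) (h g : G) : f (h * g * h⁻¹) = f g := by
  have : f (h * g * h⁻¹) - f g = 0 := by
    refine eq_zero_of_forall_nat_mul_abs_le (C := D + D) fun n => ?_
    have h1 := hf.abs_map_mul_sub_le (h * g ^ n) h⁻¹
    have h2 := hf.abs_map_mul_sub_le h (g ^ n)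
    rw [← conj_pow, hf.map_pow, hf.map_inv] at h1
    rw [hf.map_pow] at h2
    rw [← Nat.abs_cast n, ← abs_mul]
    have := abs_add_le (n * f (h * g * h⁻¹) - f (h * g ^ n) - -f h) (f (h * g ^ n) - f h - n * f g)
    calc |(n : ℝ) * (f (h * g * h⁻¹) - f g)| = _ := by congr 1; ring
      _ ≤ _ := this
      _ ≤ D + D := add_le_add h1 h2
  linarith

theorem abs_map_commutator_le (hf : IsHomogeneousQuasimorphism f D) (a b : G) :
    |f (a * b * a⁻¹ * b⁻¹)| ≤ D := by
  have := hf.abs_map_mul_sub_le (a * b * a⁻¹) b⁻¹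
  rw [hf.map_conj, hf.map_inv] at this
  simpa using this

theorem abs_map_mul_list_prod_le (hf : IsHomogeneousQuasimorphism f D) (l : List G) (a : G) :
    |f (a * l.prod) - f a - (l.map f).sum| ≤ l.length * D := by
  induction l generalizing a with
  | nil => simp
  | cons b l ih =>
    have h1 := ih (a * b)
    have h2 := hf.abs_map_mul_sub_le a b
    simp only [List.prod_cons, List.map_cons, List.sum_cons, List.length_cons, ← mul_assoc]
    rw [abs_le] at *
    push_cast
    constructor <;> linarith

/-- The estimate behind the lower bound for `scl`: a homogeneous quasimorphism of defect `D` takes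
a value of size at most `-χ · D` on the boundary of a surface. One of the boundary classes is
solved for in the surface relation, so that the relation is applied to one factor less. -/
theorem abs_boundary_le (hf : IsHomogeneousQuasimorphism f D) (S : SurfaceComponent G) :
    |∑ j, (S.degree j : ℝ) * f (S.loop j)| ≤ S.negChi * D := by
  obtain ⟨γ, p, a, b, loop, deg, cj, rel⟩ := S
  simp only [SurfaceComponent.negChi]
  have hD := hf.defect_nonneg
  rcases p with _ | p
  · simpa using by positivity
  set A := List.ofFn fun i => a i * b i * (a i)⁻¹ * (b i)⁻¹ with hA
  have hAf : ∀ x ∈ A.map f, |x| ≤ D := by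
    simp only [hA, List.map_ofFn, List.forall_mem_ofFn_iff]
    exact fun i => hf.abs_map_commutator_le _ _
  have hAs : |(A.map f).sum| ≤ γ * D := by
    have : ∀ l : List ℝ, (∀ x ∈ l, |x| ≤ D) → |l.sum| ≤ l.length * D := by
      intro l hl
      induction l with
      | nil => simp
      | cons x l ih =>
        have h1 := ih fun y hy => hl y (List.mem_cons_of_mem _ hy)
        have h2 := hl x List.mem_cons_self
        simp only [List.sum_cons, List.length_cons]
        push_cast
        linarith [abs_add_le x l.sum]
    simpa [hA] using this _ hAf
  rw [List.ofFn_succ, List.prod_cons] at rel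
  set B := List.ofFn fun j : Fin p => cj j.succ * loop j.succ ^ deg j.succ * (cj j.succ)⁻¹ with hB
  have hBs : (B.map f).sum = ∑ j : Fin p, (deg j.succ : ℝ) * f (loop j.succ) := by
    simp [hB, List.map_ofFn, List.sum_ofFn, hf.map_conj, hf.map_zpow]
  set z := cj 0 * loop 0 ^ deg 0 * (cj 0)⁻¹ with hz
  have hfz : f z = deg 0 * f (loop 0) := by rw [hz, hf.map_conj, hf.map_zpow]
  have hprod : (B ++ A).prod = z⁻¹ := by
    rw [List.prod_append, eq_inv_iff_mul_eq_one]
    have h3 : z * B.prod * A.prod = 1 := by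
      rw [mul_eq_one_iff_eq_inv, eq_comm, inv_eq_iff_mul_eq_one]
      exact rel
    rw [mul_assoc, mul_eq_one_iff_inv_eq] at h3
    rw [← h3, inv_mul_cancel]
  rw [Fin.sum_univ_succ, ← hBs, ← hfz]
  have hlen : (B ++ A).length = p + γ := by simp [hA, hB]
  have hsum : ((B ++ A).map f).sum = (B.map f).sum + (A.map f).sum := by simp
  rcases hl : B ++ A with _ | ⟨x, l⟩
  · rw [hl] at hlen hsum hprod
    have hp : p = 0 := by simp at hlen; omega
    have hg : γ = 0 := by simp at hlen; omega
    have hz1 : z = 1 := by simpa using hprod.symm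
    subst hp hg
    simp [hz1, hf.map_one, hB]
  · rw [hl] at hlen hsum hprod
    have h1 := hf.abs_map_mul_list_prod_le l x
    rw [← List.prod_cons, hprod, hf.map_inv] at h1
    rw [List.map_cons, List.sum_cons] at hsum
    have hk : (l.length : ℝ) = p + γ - 1 := by
      simp only [List.length_cons] at hlen
      have : ((l.length + 1 : ℕ) : ℝ) = (p + γ : ℕ) := by rw [hlen]
      push_cast at this
      linarith
    have hc : ((2 * γ + (p + 1) - 2 : ℕ) : ℝ) = 2 * γ + p - 1 := by
      simp only [List.length_cons] at hlen
      rw [Nat.cast_sub (by omega)]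
      push_cast
      ring
    rw [hk] at h1
    rw [hc]
    rw [abs_le] at *
    constructor <;> linarith

theorem sum_degreeOver_mul (S : SurfaceComponent G) (s : Finset G) (hs : ∀ j, S.loop j ∈ s) :
    ∑ g ∈ s, (S.degreeOver g : ℝ) * f g = ∑ j, (S.degree j : ℝ) * f (S.loop j) := by
  classical
  simp only [SurfaceComponent.degreeOver, Int.cast_sum, Finset.sum_mul]
  rw [Finset.sum_comm]
  refine Finset.sum_congr rfl fun j _ => ?_
  rw [Finset.sum_eq_single (S.loop j)]
  · simp
  · intro g _ hg
    simp [hg.symm]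
  · exact fun h => absurd (hs j) h

theorem nat_mul_abs_le_of_isAdmissible (hf : IsHomogeneousQuasimorphism f D) {c : IntegralChain G}
    {S : List (SurfaceComponent G)} {n : ℕ} (h : IsAdmissible c S n) :
    n * |c.sum fun g k => k * f g| ≤ ((S.map SurfaceComponent.negChi).sum : ℕ) * D := by
  obtain ⟨-, hloop, hdeg⟩ := h
  have key : (n : ℝ) * (c.sum fun g k => k * f g) =
      (S.map fun s => ∑ j, (s.degree j : ℝ) * f (s.loop j)).sum := by
    have h1 : (S.map fun s => ∑ j, (s.degree j : ℝ) * f (s.loop j)) =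
        S.map fun s => ∑ g ∈ c.support, (s.degreeOver g : ℝ) * f g :=
      List.map_congr_left fun s hs => (sum_degreeOver_mul s _ (hloop s hs)).symm
    have h2 : ∀ (L : List (SurfaceComponent G)),
        (L.map fun s => ∑ g ∈ c.support, (s.degreeOver g : ℝ) * f g).sum =
        ∑ g ∈ c.support, ((L.map fun s => s.degreeOver g).sum : ℤ) * f g := by
      intro L
      induction L with
      | nil => simp
      | cons s L ih => simp [ih, add_mul, Finset.sum_add_distrib]
    rw [h1, h2, Finsupp.sum, Finset.mul_sum]
    refine Finset.sum_congr rfl fun g _ => ?_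
    rw [hdeg]
    push_cast
    ring
  rw [← Nat.abs_cast n, ← abs_mul, key]
  clear key hloop hdeg
  induction S with
  | nil => simp
  | cons s S ih =>
    have := hf.abs_boundary_le s
    simp only [List.map_cons, List.sum_cons]
    push_cast at ih ⊢
    linarith [abs_add_le (∑ j, (s.degree j : ℝ) * f (s.loop j))
      (S.map fun s => ∑ j, (s.degree j : ℝ) * f (s.loop j)).sum]

open scoped ENNReal in
/-- The easy half of Bavard duality for chains. -/
theorem ofReal_le_scl (hf : IsHomogeneousQuasimorphism f D) (hD : 0 < D) (c : IntegralChain G) :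
    ENNReal.ofReal (|c.sum fun g k => k * f g| / (2 * D)) ≤ scl c := by
  refine le_iInf fun S => le_iInf fun n => le_iInf fun h => ?_
  have hn : (0 : ℝ) < n := by exact_mod_cast h.1
  have h1 := hf.nat_mul_abs_le_of_isAdmissible h
  have h2 : (((S.map SurfaceComponent.negChi).sum : ℕ) : ℝ≥0∞) / (2 * (n : ℝ≥0∞)) =
      ENNReal.ofReal (((S.map SurfaceComponent.negChi).sum : ℕ) / (2 * n)) := by
    rw [ENNReal.ofReal_div_of_pos (by positivity), ENNReal.ofReal_natCast,
      ENNReal.ofReal_mul (by norm_num), ENNReal.ofReal_natCast]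
    simp
  rw [h2]
  refine ENNReal.ofReal_le_ofReal ?_
  rw [div_le_div_iff₀ (by positivity) (by positivity)]
  nlinarith

/-- A homogeneous quasimorphism descends to chains up to equivalence. -/
theorem linearCombination_eq_zero (hf : IsHomogeneousQuasimorphism f D) {x : RealChain G}
    (hx : x ∈ equivSubspace G) : Finsupp.linearCombination ℝ f x = 0 := by
  have : equivSubspace G ≤ LinearMap.ker (Finsupp.linearCombination ℝ f) := by
    refine Submodule.span_le.mpr ?_
    rintro x ((⟨g, n, rfl⟩ | ⟨g, h, rfl⟩) | ⟨g, h, hgh, rfl⟩)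
    · simp [hf.map_zpow]
    · simp [hf.map_conj]
    · simp [hf.map_mul_of_commute hgh]
  exact this hx

theorem sum_eq_of_equivalent (hf : IsHomogeneousQuasimorphism f D) {c c' : IntegralChain G}
    (h : Equivalent c.toReal c'.toReal) :
    (c.sum fun g k => k * f g) = c'.sum fun g k => k * f g := by
  have h1 := hf.linearCombination_eq_zero h
  have h2 : ∀ d : IntegralChain G,
      Finsupp.linearCombination ℝ f d.toReal = d.sum fun g k => k * f g := by
    intro d
    rw [Finsupp.linearCombination_apply, IntegralChain.toReal, Finsupp.sum_mapRange_index]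
    · rfl
    · simp
  rw [map_sub, h2, h2] at h1
  linarith

end IsHomogeneousQuasimorphism

/-! ### Homogenization -/

/-- Reversing a product of three factors costs one commutator. -/
theorem exists_mul_reverse_eq_commutator_mul (t p q r : G) :
    ∃ x y, t * p * q * r = x * y * x⁻¹ * y⁻¹ * (t * r * q * p) :=
  ⟨t * (p * q) * t⁻¹, t * (r * p⁻¹) * t⁻¹, by group⟩

section

variable {h : G → ℝ} {D : ℝ}

theorem abs_map_commutator_mul_sub_le (hD : ∀ a b, |h (a * b) - h a - h b| ≤ D)
    (hinv : ∀ a, h a⁻¹ = -h a) (a b x : G) : |h (a * b * a⁻¹ * b⁻¹ * x) - h x| ≤ 4 * D := by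
  have h1 := hD a (b * (a⁻¹ * (b⁻¹ * x)))
  have h2 := hD b (a⁻¹ * (b⁻¹ * x))
  have h3 := hD a⁻¹ (b⁻¹ * x)
  have h4 := hD b⁻¹ x
  rw [hinv] at h3 h4
  simp only [mul_assoc]
  rw [abs_le] at *
  constructor <;> linarith

/-- `(a b) ^ (2 m + 1)` is a product of `m` commutators times `a ^ (m + 1) b ^ (2 m + 1) a ^ m`.
Half a commutator per factor is what makes the defect of a homogenization only twice the original
one. -/
theorem exists_mul_pow_eq (hD : ∀ a b, |h (a * b) - h a - h b| ≤ D)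
    (hinv : ∀ a, h a⁻¹ = -h a) (a b : G) (m : ℕ) :
    ∃ c, (a * b) ^ (2 * m + 1) = c * (a ^ (m + 1) * b ^ (2 * m + 1) * a ^ m) ∧
      ∀ x, |h (c * x) - h x| ≤ 4 * D * m := by
  induction m with
  | zero => exact ⟨1, by simp, by simp⟩
  | succ m ih =>
    obtain ⟨c, hc, hx⟩ := ih
    obtain ⟨y, z, key⟩ :=
      exists_mul_reverse_eq_commutator_mul (a ^ (m + 1)) (b ^ (2 * m + 1) * a ^ (m + 1)) b (a * b)
    refine ⟨c * (y * z * y⁻¹ * z⁻¹), ?_, fun x => ?_⟩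
    · have e1 : (a * b) ^ (2 * (m + 1) + 1) = (a * b) ^ (2 * m + 1) * (a * b * (a * b)) := by
        rw [← pow_two, ← pow_add]; congr 1
      have e2 : a ^ (m + 1) * b ^ (2 * m + 1) * a ^ m * (a * b * (a * b)) =
          a ^ (m + 1) * (b ^ (2 * m + 1) * a ^ (m + 1)) * b * (a * b) := by
        rw [pow_succ a m]; simp only [mul_assoc]
      have e3 : a ^ (m + 1) * (a * b) * b * (b ^ (2 * m + 1) * a ^ (m + 1)) =
          a ^ (m + 1 + 1) * b ^ (2 * (m + 1) + 1) * a ^ (m + 1) := by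
        rw [pow_succ a (m + 1), show 2 * (m + 1) + 1 = 1 + (1 + (2 * m + 1)) by ring, pow_add b 1,
          pow_add b 1, pow_one]
        simp only [mul_assoc]
      rw [e1, hc, mul_assoc c, e2, key, e3, mul_assoc c]
    · have h1 := hx (y * z * y⁻¹ * z⁻¹ * x)
      have h2 := abs_map_commutator_mul_sub_le hD hinv y z x
      rw [mul_assoc c]
      push_cast
      rw [abs_le] at *
      constructor <;> linarith

theorem exists_tendsto_div (hD : ∀ a b, |h (a * b) - h a - h b| ≤ D) (g : G) :
    ∃ x : ℝ, Tendsto (fun n : ℕ => h (g ^ n) / n) atTop (𝓝 x) := by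
  have hD0 : 0 ≤ D := (abs_nonneg _).trans (hD 1 1)
  have hsub : Subadditive fun n : ℕ => h (g ^ n) + D := by
    intro m n
    have := (abs_le.mp (hD (g ^ m) (g ^ n))).2
    rw [← pow_add] at this
    linarith
  have hlow : ∀ n : ℕ, n * (h g - D) - D - |h 1| ≤ h (g ^ n) := by
    intro n
    induction n with
    | zero => simp; linarith [neg_abs_le (h 1)]
    | succ n ih =>
      have := (abs_le.mp (hD (g ^ n) g)).1
      rw [← pow_succ] at this
      push_cast
      linarith
  have hbdd : BddBelow (Set.range fun n : ℕ => (h (g ^ n) + D) / n) := by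
    refine ⟨-(|h g - D| + |h 1|), ?_⟩
    rintro _ ⟨n, rfl⟩
    rcases Nat.eq_zero_or_pos n with rfl | hn
    · have h1 := abs_nonneg (h g - D)
      have h2 := abs_nonneg (h 1)
      simp only [Nat.cast_zero, div_zero]
      linarith
    have hn' : (1 : ℝ) ≤ n := by exact_mod_cast hn
    simp only
    rw [le_div_iff₀ (by linarith)]
    nlinarith [hlow n, neg_abs_le (h g - D), abs_nonneg (h 1), abs_nonneg (h g - D)]
  refine ⟨hsub.lim, ?_⟩
  have h1 := hsub.tendsto_lim hbdd
  have h2 : Tendsto (fun n : ℕ => D / (n : ℝ)) atTop (𝓝 0) :=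
    tendsto_const_div_atTop_nhds_zero_nat D
  have h3 := h1.sub h2
  rw [sub_zero] at h3
  refine h3.congr fun n => ?_
  ring

/-- The homogenization of an antisymmetric quasimorphism of defect `D` has defect at most
`2 * D`. -/
theorem isHomogeneousQuasimorphism_of_tendsto (hD : ∀ a b, |h (a * b) - h a - h b| ≤ D)
    (hinv : ∀ a, h a⁻¹ = -h a) {f : G → ℝ}
    (hf : ∀ g, Tendsto (fun n : ℕ => h (g ^ n) / n) atTop (𝓝 (f g))) :
    IsHomogeneousQuasimorphism f (2 * D) where
  map_pow g n := by
    rcases Nat.eq_zero_or_pos n with rfl | hn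
    · have h1 : h 1 = 0 := by
        have := hinv 1
        rw [inv_one] at this
        linarith
      have := hf 1
      simp only [one_pow, h1, zero_div] at this
      simpa using (tendsto_nhds_unique this tendsto_const_nhds)
    have hn' : (n : ℝ) ≠ 0 := by positivity
    have h1 := ((hf g).comp (tendsto_id.const_mul_atTop' hn)).const_mul (n : ℝ)
    refine tendsto_nhds_unique (hf (g ^ n)) (h1.congr fun k => ?_)
    simp only [Function.comp, id]
    rw [← pow_mul]
    push_cast
    field_simp
  abs_map_mul_sub_le a b := by
    have hodd : Tendsto (fun m : ℕ => 2 * m + 1) atTop atTop :=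
      tendsto_atTop_mono (fun m => by simp only [id]; omega) tendsto_id
    have hdiv : ∀ k : ℕ, Tendsto (fun m : ℕ => ((m + k : ℕ) : ℝ) / ((2 * m + 1 : ℕ) : ℝ)) atTop
        (𝓝 (1 / 2)) := by
      intro k
      have e : ∀ m : ℕ, ((m + k : ℕ) : ℝ) / ((2 * m + 1 : ℕ) : ℝ) =
          1 / 2 + (k - 1 / 2) / ((2 * m + 1 : ℕ) : ℝ) := by
        intro m
        have : ((2 * m + 1 : ℕ) : ℝ) ≠ 0 := by positivity
        field_simp
        push_cast
        ring
      simp only [e]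
      have := (tendsto_const_div_atTop_nhds_zero_nat ((k : ℝ) - 1 / 2)).comp hodd
      simpa using this.const_add (1 / 2 : ℝ)
    have hsub : ∀ (g : G) (k : ℕ),
        Tendsto (fun m : ℕ => h (g ^ (m + k)) / ((2 * m + 1 : ℕ) : ℝ)) atTop (𝓝 (f g / 2)) := by
      intro g k
      have h1 := ((hf g).comp (tendsto_add_atTop_nat k)).mul (hdiv k)
      rw [show f g * (1 / 2) = f g / 2 by ring] at h1
      refine h1.congr' ?_
      filter_upwards [eventually_gt_atTop 0] with m hm
      have : ((m + k : ℕ) : ℝ) ≠ 0 := by positivity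
      simp only [Function.comp]
      field_simp
    have hlim := ((((hf (a * b)).comp hodd).sub (hsub a 1)).sub ((hf b).comp hodd)).sub (hsub a 0)
    have hlim' := hlim.abs
    rw [show f (a * b) - f a / 2 - f b - f a / 2 = f (a * b) - f a - f b by ring] at hlim'
    have hbound : Tendsto (fun m : ℕ => 4 * D * (((m + 0 : ℕ) : ℝ) / ((2 * m + 1 : ℕ) : ℝ)) +
        2 * D / ((2 * m + 1 : ℕ) : ℝ)) atTop (𝓝 (2 * D)) := by
      have h1 := ((hdiv 0).const_mul (4 * D)).add
        ((tendsto_const_div_atTop_nhds_zero_nat (2 * D)).comp hodd)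
      rw [show 4 * D * (1 / 2) + 0 = 2 * D by ring] at h1
      exact h1
    refine le_of_tendsto_of_tendsto' hlim' hbound fun m => ?_
    obtain ⟨c, hc, hx⟩ := exists_mul_pow_eq hD hinv a b m
    have h1 := hx (a ^ (m + 1) * b ^ (2 * m + 1) * a ^ m)
    rw [← hc] at h1
    have h2 := hD (a ^ (m + 1) * b ^ (2 * m + 1)) (a ^ m)
    have h3 := hD (a ^ (m + 1)) (b ^ (2 * m + 1))
    have hpos : (0 : ℝ) < ((2 * m + 1 : ℕ) : ℝ) := by positivity
    simp only [Function.comp, add_zero]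
    rw [← sub_div, ← sub_div, ← sub_div, abs_div, abs_of_pos hpos, ← mul_div_assoc, ← add_div]
    gcongr
    rw [abs_le] at *
    constructor <;> linarith

end

end StableCommutatorLength

/-! ### The metric of a tree -/

namespace SimpleGraph.IsTree

variable {X : Type*} {Γ : SimpleGraph X}

/-- A walk that changes sides of the bridge from `e'` to `e` has to cross it. -/
theorem dist_add_one_add_dist_le_length {e e' : X}
    (hbr : ¬ (Γ.deleteEdges {s(e', e)}).Reachable e' e) {a b : X} (w : Γ.Walk a b)
    (ha : (Γ.deleteEdges {s(e', e)}).Reachable a e')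
    (hb : (Γ.deleteEdges {s(e', e)}).Reachable b e) (hΓ : Γ.IsTree) :
    Γ.dist a e' + 1 + Γ.dist e b ≤ w.length := by
  induction w with
  | nil => exact absurd (ha.symm.trans hb) hbr
  | @cons a a₁ b hadj w ih =>
    rw [Walk.length_cons]
    by_cases h : s(a, a₁) = s(e', e)
    · rcases Sym2.eq_iff.mp h with ⟨rfl, rfl⟩ | ⟨rfl, rfl⟩
      · have := dist_le w
        rw [dist_self]
        omega
      · exact absurd ha.symm hbr
    · have h' : (Γ.deleteEdges {s(e', e)}).Adj a a₁ := by
        rw [deleteEdges_adj]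
        exact ⟨hadj, by simpa using h⟩
      have h1 := ih (h'.reachable.symm.trans ha) hb
      have h2 := hΓ.connected.dist_triangle (u := a) (v := a₁) (w := e')
      rw [dist_eq_one_iff_adj.mpr hadj] at h2
      omega

/-- A geodesic between two points that lie on different sides of an edge crosses that edge. -/
theorem dist_eq_of_separated (hΓ : Γ.IsTree) {a b e e' : X} (hadj : Γ.Adj e' e)
    (ha : Γ.dist a e = Γ.dist a e' + 1) (hb : Γ.dist b e' = Γ.dist b e + 1) :
    Γ.dist a b = Γ.dist a e' + 1 + Γ.dist e b := by
  have hbr : ¬ (Γ.deleteEdges {s(e', e)}).Reachable e' e :=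
    isAcyclic_iff_forall_adj_isBridge.mp hΓ.isAcyclic hadj
  have hbr' : ¬ (Γ.deleteEdges {s(e, e')}).Reachable e e' := by
    rw [Sym2.eq_swap]
    exact fun h => hbr h.symm
  have hside : ∀ x, (Γ.deleteEdges {s(e', e)}).Reachable x e' ∨
      (Γ.deleteEdges {s(e', e)}).Reachable x e := by
    intro x
    obtain ⟨w⟩ := hΓ.connected.preconnected x e'
    induction w with
    | nil => exact Or.inl (Reachable.refl _)
    | @cons x y z hxy w ih =>
      by_cases h : s(x, y) = s(z, e)
      · rcases Sym2.eq_iff.mp h with ⟨rfl, rfl⟩ | ⟨rfl, rfl⟩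
        · exact Or.inl (Reachable.refl _)
        · exact Or.inr (Reachable.refl _)
      · have h' : (Γ.deleteEdges {s(z, e)}).Adj x y := by
          rw [deleteEdges_adj]
          exact ⟨hxy, by simpa using h⟩
        exact (ih hadj ha hb hbr hbr').imp h'.reachable.trans h'.reachable.trans
  have ha' : (Γ.deleteEdges {s(e', e)}).Reachable a e' := by
    refine (hside a).resolve_right fun h => ?_
    obtain ⟨w, hw⟩ := hΓ.connected.exists_walk_length_eq_dist a e'
    have := dist_add_one_add_dist_le_length hbr' w (by rwa [Sym2.eq_swap]) (Reachable.refl _) hΓ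
    omega
  have hb' : (Γ.deleteEdges {s(e', e)}).Reachable b e := by
    refine (hside b).resolve_left fun h => ?_
    obtain ⟨w, hw⟩ := hΓ.connected.exists_walk_length_eq_dist b e
    have := dist_add_one_add_dist_le_length hbr w h (Reachable.refl _) hΓ
    omega
  obtain ⟨w, hw⟩ := hΓ.connected.exists_walk_length_eq_dist a b
  have h1 := dist_add_one_add_dist_le_length hbr w ha' hb' hΓ
  have h2 := hΓ.connected.dist_triangle (u := a) (v := e') (w := b)
  have h3 := hΓ.connected.dist_triangle (u := e') (v := e) (w := b)
  rw [dist_eq_one_iff_adj.mpr hadj] at h3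
  omega

/-- The four-point condition: of the three ways to sum distances in opposite pairs, the two largest
agree. -/
theorem four_point (hΓ : Γ.IsTree) (a b c e : X) :
    Γ.dist a b + Γ.dist c e ≤ max (Γ.dist a c + Γ.dist b e) (Γ.dist a e + Γ.dist b c) ∧
    Γ.dist a c + Γ.dist b e ≤ max (Γ.dist a b + Γ.dist c e) (Γ.dist a e + Γ.dist b c) ∧
    Γ.dist a e + Γ.dist b c ≤ max (Γ.dist a b + Γ.dist c e) (Γ.dist a c + Γ.dist b e) := by
  obtain ⟨w⟩ := hΓ.connected.preconnected e c
  induction w with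
  | @nil c =>
    have := hΓ.connected.dist_triangle (u := a) (v := c) (w := b)
    have := dist_comm (G := Γ) (u := c) (v := b)
    simp only [dist_self]
    omega
  | @cons e e' c hadj w ih =>
    have c1 := dist_comm (G := Γ) (u := c) (v := b)
    have c2 := dist_comm (G := Γ) (u := b) (v := a)
    have c3 := dist_comm (G := Γ) (u := c) (v := a)
    have c4 := dist_comm (G := Γ) (u := e) (v := a)
    have c5 := dist_comm (G := Γ) (u := e) (v := b)
    have c6 := dist_comm (G := Γ) (u := e) (v := c)
    have c7 := dist_comm (G := Γ) (u := e') (v := a)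
    have c8 := dist_comm (G := Γ) (u := e') (v := b)
    have c9 := dist_comm (G := Γ) (u := e') (v := c)
    have t4 := hΓ.connected.dist_triangle (u := a) (v := e) (w := b)
    have t5 := hΓ.connected.dist_triangle (u := a) (v := e) (w := c)
    have t6 := hΓ.connected.dist_triangle (u := b) (v := e) (w := c)
    have t7 := hΓ.connected.dist_triangle (u := a) (v := e') (w := b)
    have t8 := hΓ.connected.dist_triangle (u := a) (v := e') (w := c)
    have t9 := hΓ.connected.dist_triangle (u := b) (v := e') (w := c)
    have sep := fun {x y : X} => hΓ.dist_eq_of_separated (a := x) (b := y) hadj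
    have sep' := fun {x y : X} => hΓ.dist_eq_of_separated (a := x) (b := y) hadj.symm
    rcases hΓ.dist_eq_dist_add_one_of_adj a hadj with ha | ha <;>
    rcases hΓ.dist_eq_dist_add_one_of_adj b hadj with hb | hb <;>
    rcases hΓ.dist_eq_dist_add_one_of_adj c hadj with hc | hc
    · omega
    · have := sep' ha hc
      have := sep' hb hc
      omega
    · have := sep' ha hb
      have := sep' hc hb
      omega
    · have := sep' ha hb
      have := sep' ha hc
      omega
    · have := sep ha hb
      have := sep ha hc
      omega
    · have := sep ha hb
      have := sep hc hb
      omega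
    · have := sep ha hc
      have := sep hb hc
      omega
    · omega

theorem dist_perimeter_even (hΓ : Γ.IsTree) (p q r : X) :
    (Γ.dist p q + Γ.dist q r + Γ.dist p r) % 2 = 0 := by
  obtain ⟨w⟩ := hΓ.connected.preconnected r p
  induction w with
  | @nil p =>
    have := dist_comm (G := Γ) (u := p) (v := q)
    simp only [dist_self]
    omega
  | @cons r r' p hadj w ih =>
    have h1 := hΓ.dist_eq_dist_add_one_of_adj p hadj
    have h2 := hΓ.dist_eq_dist_add_one_of_adj q hadj
    omega

theorem exists_geodesic (hΓ : Γ.IsTree) (p q : X) :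
    ∃ P : ℕ → X, P 0 = p ∧ P (Γ.dist p q) = q ∧
      ∀ i j, i ≤ j → j ≤ Γ.dist p q → Γ.dist (P i) (P j) = j - i := by
  obtain ⟨w, hw⟩ := hΓ.connected.exists_walk_length_eq_dist p q
  have hle : ∀ i k, i + k ≤ Γ.dist p q → Γ.dist (w.getVert i) (w.getVert (i + k)) ≤ k := by
    intro i k
    induction k with
    | zero => simp
    | succ k ih =>
      intro hk
      have h1 := ih (by omega)
      have h2 := hΓ.connected.dist_triangle (u := w.getVert i) (v := w.getVert (i + k))
        (w := w.getVert (i + (k + 1)))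
      have h3 : Γ.dist (w.getVert (i + k)) (w.getVert (i + (k + 1))) = 1 :=
        dist_eq_one_iff_adj.mpr (w.adj_getVert_succ (by omega))
      omega
  refine ⟨w.getVert, w.getVert_zero, ?_, fun i j hij hj => ?_⟩
  · rw [← hw, w.getVert_length]
  · have h1 := hle i (j - i) (by omega)
    have h2 := hle 0 i (by omega)
    have h3 := hle j (Γ.dist p q - j) (by omega)
    rw [show i + (j - i) = j by omega] at h1
    rw [zero_add, w.getVert_zero] at h2
    rw [show j + (Γ.dist p q - j) = w.length by omega, w.getVert_length] at h3
    have h4 := hΓ.connected.dist_triangle (u := p) (v := w.getVert i) (w := q)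
    have h5 := hΓ.connected.dist_triangle (u := w.getVert i) (v := w.getVert j) (w := q)
    omega

theorem exists_dist_eq (hΓ : Γ.IsTree) {p q : X} {k : ℕ} (hk : k ≤ Γ.dist p q) :
    ∃ o, Γ.dist p o = k ∧ Γ.dist p o + Γ.dist o q = Γ.dist p q := by
  obtain ⟨P, h0, h1, hP⟩ := hΓ.exists_geodesic p q
  have h2 := hP 0 k (by omega) hk
  have h3 := hP k _ hk le_rfl
  rw [h0] at h2
  rw [h1] at h3
  exact ⟨P k, by omega, by omega⟩

/-- Any three vertices of a tree have a median. -/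
theorem exists_median (hΓ : Γ.IsTree) (p q r : X) :
    ∃ o, Γ.dist p o + Γ.dist o q = Γ.dist p q ∧ Γ.dist q o + Γ.dist o r = Γ.dist q r ∧
      Γ.dist p o + Γ.dist o r = Γ.dist p r := by
  have t1 := hΓ.connected.dist_triangle (u := p) (v := q) (w := r)
  have t2 := hΓ.connected.dist_triangle (u := p) (v := r) (w := q)
  have t3 := hΓ.connected.dist_triangle (u := q) (v := p) (w := r)
  have c1 := dist_comm (G := Γ) (u := q) (v := p)
  have c2 := dist_comm (G := Γ) (u := r) (v := q)
  have ev := hΓ.dist_perimeter_even p q r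
  -- The median is at distance half of `pq + pr - qr`, the Gromov product, from `p`.
  obtain ⟨o, ho, ho'⟩ := hΓ.exists_dist_eq (p := p) (q := q)
    (k := (Γ.dist p q + Γ.dist p r - Γ.dist q r) / 2) (by omega)
  have h4 := hΓ.four_point p q o r
  have s1 := hΓ.connected.dist_triangle (u := p) (v := o) (w := r)
  have s2 := hΓ.connected.dist_triangle (u := q) (v := o) (w := r)
  have c3 := dist_comm (G := Γ) (u := q) (v := o)
  exact ⟨o, by omega, by omega, by omega⟩

/-- Two points of a geodesic are ordered along it. -/
theorem dist_eq_sub_of_mem (hΓ : Γ.IsTree) {p q a b : X}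
    (ha : Γ.dist p a + Γ.dist a q = Γ.dist p q) (hb : Γ.dist p b + Γ.dist b q = Γ.dist p q)
    (hab : Γ.dist p a ≤ Γ.dist p b) : Γ.dist a b = Γ.dist p b - Γ.dist p a := by
  have h4 := hΓ.four_point p q a b
  have t1 := hΓ.connected.dist_triangle (u := p) (v := a) (w := b)
  have c1 := dist_comm (G := Γ) (u := q) (v := b)
  have c2 := dist_comm (G := Γ) (u := q) (v := a)
  omega

/-- Geodesics that overlap in a nondegenerate segment fit together to a geodesic. -/
theorem dist_eq_of_overlap (hΓ : Γ.IsTree) {a b c e : X}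
    (h1 : Γ.dist a b + Γ.dist b c = Γ.dist a c) (h2 : Γ.dist b c + Γ.dist c e = Γ.dist b e)
    (hbc : 0 < Γ.dist b c) : Γ.dist a e = Γ.dist a b + Γ.dist b c + Γ.dist c e := by
  have h4 := hΓ.four_point a b c e
  have t1 := hΓ.connected.dist_triangle (u := a) (v := b) (w := e)
  omega

theorem eq_of_dist_eq_zero (hΓ : Γ.IsTree) {a b : X} (h : Γ.dist a b = 0) : a = b :=
  hΓ.connected.dist_eq_zero_iff.mp h

end SimpleGraph.IsTree

open StableCommutatorLength

/-! ### Counting quasimorphisms of an action on a tree -/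

namespace TreeAction

/-- `G` acts on the tree `Γ` by graph automorphisms and without inversions. -/
structure IsTreeAction (G : Type*) [Group G] {X : Type*} [MulAction G X] (Γ : SimpleGraph X) :
    Prop where
  isTree : Γ.IsTree
  adj_smul : ∀ (g : G) {x y : X}, Γ.Adj x y → Γ.Adj (g • x) (g • y)
  no_inversion : ∀ (g : G) {x y : X}, Γ.Adj x y → g • x = y → g • y ≠ x

variable {G : Type*} [Group G] {X : Type*} [MulAction G X] {Γ : SimpleGraph X}

theorem IsTreeAction.dist_smul (hA : IsTreeAction G Γ) (g : G) (x y : X) :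
    Γ.dist (g • x) (g • y) = Γ.dist x y := by
  have hle : ∀ (g : G) (x y : X), Γ.dist (g • x) (g • y) ≤ Γ.dist x y := by
    intro g x y
    obtain ⟨w, hw⟩ := hA.isTree.connected.exists_walk_length_eq_dist x y
    let φ : Γ →g Γ := ⟨fun x => g • x, hA.adj_smul g⟩
    have := SimpleGraph.dist_le (w.map φ)
    rw [SimpleGraph.Walk.length_map, hw] at this
    exact this
  refine le_antisymm (hle g x y) ?_
  simpa using hle g⁻¹ (g • x) (g • y)

variable (G Γ) in
/-- `Copies G Γ u v n p q`: the geodesic from `p` to `q` passes through `n` successive translates of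
the directed segment from `u` to `v`, which do not overlap (they may share end points). -/
def Copies (u v : X) : ℕ → X → X → Prop
  | 0, _, _ => True
  | n + 1, p, q => ∃ g : G, Γ.dist p (g • u) + Γ.dist u v + Γ.dist (g • v) q = Γ.dist p q ∧
      Copies u v n (g • v) q

variable {u v : X}

theorem Copies.mul_dist_le {n : ℕ} {p q : X}
    (h : Copies G Γ u v n p q) : n * Γ.dist u v ≤ Γ.dist p q := by
  induction n generalizing p with
  | zero => simp
  | succ n ih =>
    obtain ⟨g, h1, h2⟩ := h
    have := ih h2
    rw [Nat.succ_mul]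
    omega

theorem Copies.smul (hA : IsTreeAction G Γ) (k : G) {n : ℕ} {p q : X}
    (h : Copies G Γ u v n p q) : Copies G Γ u v n (k • p) (k • q) := by
  induction n generalizing p with
  | zero => trivial
  | succ n ih =>
    obtain ⟨g, h1, h2⟩ := h
    refine ⟨k * g, ?_, ?_⟩
    · simpa only [mul_smul, hA.dist_smul] using h1
    · simpa only [mul_smul] using ih h2

theorem Copies.extend_left (hA : IsTreeAction G Γ) {n : ℕ} {p o q : X}
    (ho : Γ.dist p o + Γ.dist o q = Γ.dist p q) (h : Copies G Γ u v n o q) :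
    Copies G Γ u v n p q := by
  cases n with
  | zero => trivial
  | succ n =>
    obtain ⟨g, h1, h2⟩ := h
    refine ⟨g, ?_, h2⟩
    have t1 := hA.isTree.connected.dist_triangle (u := p) (v := o) (w := g • u)
    have t2 := hA.isTree.connected.dist_triangle (u := p) (v := g • u) (w := q)
    have t3 := hA.isTree.connected.dist_triangle (u := g • u) (v := g • v) (w := q)
    rw [hA.dist_smul] at t3
    omega

theorem Copies.append (hA : IsTreeAction G Γ) {m n : ℕ} {p o q : X}
    (ho : Γ.dist p o + Γ.dist o q = Γ.dist p q) (h : Copies G Γ u v m p o)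
    (h' : Copies G Γ u v n o q) : Copies G Γ u v (m + n) p q := by
  induction m generalizing p with
  | zero => simpa using h'.extend_left hA ho
  | succ m ih =>
    obtain ⟨g, h1, h2⟩ := h
    have t1 := hA.isTree.connected.dist_triangle (u := p) (v := g • u) (w := q)
    have t2 := hA.isTree.connected.dist_triangle (u := g • u) (v := g • v) (w := q)
    have t3 := hA.isTree.connected.dist_triangle (u := g • v) (v := o) (w := q)
    rw [hA.dist_smul] at t2
    rw [Nat.succ_add]
    exact ⟨g, by omega, ih (by omega) h2⟩

/-- Cutting a geodesic destroys at most one copy. -/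
theorem Copies.split (hA : IsTreeAction G Γ) {n : ℕ} {p o q : X}
    (ho : Γ.dist p o + Γ.dist o q = Γ.dist p q) (h : Copies G Γ u v n p q) :
    ∃ a b, n ≤ a + b + 1 ∧ Copies G Γ u v a p o ∧ Copies G Γ u v b o q := by
  induction n generalizing p with
  | zero => exact ⟨0, 0, by omega, trivial, trivial⟩
  | succ n ih =>
    obtain ⟨g, h1, h2⟩ := h
    have t1 := hA.isTree.connected.dist_triangle (u := p) (v := g • u) (w := g • v)
    have t2 := hA.isTree.connected.dist_triangle (u := p) (v := g • v) (w := q)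
    have t3 := hA.isTree.connected.dist_triangle (u := p) (v := g • u) (w := q)
    have t4 := hA.isTree.connected.dist_triangle (u := g • u) (v := g • v) (w := q)
    have c1 := SimpleGraph.dist_comm (G := Γ) (u := g • v) (v := o)
    rw [hA.dist_smul] at t1 t4
    rcases le_total (Γ.dist p (g • v)) (Γ.dist p o) with hle | hle
    · have h3 := hA.isTree.dist_eq_sub_of_mem (a := g • v) (b := o) (by omega) ho hle
      obtain ⟨a, b, hab, ha, hb⟩ := ih (p := g • v) (by omega) h2
      exact ⟨a + 1, b, by omega, ⟨g, by omega, ha⟩, hb⟩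
    · have h3 := hA.isTree.dist_eq_sub_of_mem (a := o) (b := g • v) ho (by omega) hle
      exact ⟨0, n, by omega, trivial, h2.extend_left hA (by omega)⟩

variable (G Γ) in
/-- The greatest number of copies of the directed segment from `u` to `v` on the geodesic from `p`
to `q`; the supremum is over a bounded set if `u ≠ v`. -/
noncomputable def count (u v p q : X) : ℕ := sSup {n | Copies G Γ u v n p q}

theorem bddAbove_copies (huv : 0 < Γ.dist u v) (p q : X) :
    BddAbove {n | Copies G Γ u v n p q} :=
  ⟨Γ.dist p q, fun _ hn => (Nat.le_mul_of_pos_right _ huv).trans (hn.mul_dist_le)⟩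

theorem Copies.le_count (huv : 0 < Γ.dist u v) {n : ℕ} {p q : X}
    (h : Copies G Γ u v n p q) : n ≤ count G Γ u v p q :=
  le_csSup (bddAbove_copies huv p q) h

theorem copies_count (huv : 0 < Γ.dist u v) (p q : X) :
    Copies G Γ u v (count G Γ u v p q) p q :=
  Nat.sSup_mem (s := {n | Copies G Γ u v n p q}) ⟨0, by trivial⟩ (bddAbove_copies huv p q)

theorem count_smul (hA : IsTreeAction G Γ) (huv : 0 < Γ.dist u v) (k : G) (p q : X) :
    count G Γ u v (k • p) (k • q) = count G Γ u v p q := by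
  refine le_antisymm ?_ (((copies_count huv p q).smul hA k).le_count huv)
  have := ((copies_count huv (k • p) (k • q)).smul hA k⁻¹).le_count huv
  simpa using this

theorem count_add_le (hA : IsTreeAction G Γ) (huv : 0 < Γ.dist u v) {p o q : X}
    (ho : Γ.dist p o + Γ.dist o q = Γ.dist p q) :
    count G Γ u v p o + count G Γ u v o q ≤ count G Γ u v p q :=
  ((copies_count huv p o).append hA ho (copies_count huv o q)).le_count huv

theorem count_le_add (hA : IsTreeAction G Γ) (huv : 0 < Γ.dist u v) {p o q : X}
    (ho : Γ.dist p o + Γ.dist o q = Γ.dist p q) :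
    count G Γ u v p q ≤ count G Γ u v p o + count G Γ u v o q + 1 := by
  obtain ⟨a, b, hab, ha, hb⟩ := (copies_count huv p q).split hA ho
  have := ha.le_count huv
  have := hb.le_count huv
  omega

theorem count_eq_zero (huv : 0 < Γ.dist u v) {p q : X}
    (h : ∀ g : G, Γ.dist p (g • u) + Γ.dist u v + Γ.dist (g • v) q ≠ Γ.dist p q) :
    count G Γ u v p q = 0 := by
  by_contra h0
  obtain ⟨n, hn⟩ := Nat.exists_eq_succ_of_ne_zero h0
  have h1 := copies_count (G := G) huv p q
  rw [hn] at h1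
  obtain ⟨g, hg, -⟩ := h1
  exact h g hg

variable (G Γ) in
/-- The number of copies of the segment from `u` to `v` minus the number of copies of the reversed
segment, which are the copies met on the way back. -/
noncomputable def signedCount (u v p q : X) : ℤ := count G Γ u v p q - count G Γ u v q p

theorem signedCount_swap (p q : X) :
    signedCount G Γ u v q p = -signedCount G Γ u v p q := by
  simp [signedCount]

theorem signedCount_smul (hA : IsTreeAction G Γ) (huv : 0 < Γ.dist u v) (k : G) (p q : X) :
    signedCount G Γ u v (k • p) (k • q) = signedCount G Γ u v p q := by
  simp [signedCount, count_smul hA huv]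

/-- Each of the three sides of a tripod is cut once, at the median, with an error of at most `1`;
the contributions of the three legs cancel. -/
theorem abs_signedCount_triangle_le (hA : IsTreeAction G Γ) (huv : 0 < Γ.dist u v) (p q r : X) :
    |signedCount G Γ u v p r - signedCount G Γ u v p q - signedCount G Γ u v q r| ≤ 3 := by
  obtain ⟨o, h1, h2, h3⟩ := hA.isTree.exists_median p q r
  have swap : ∀ {a b c : X}, Γ.dist a b + Γ.dist b c = Γ.dist a c →
      Γ.dist c b + Γ.dist b a = Γ.dist c a := by
    intro a b c h
    rw [Γ.dist_comm (u := c) (v := b), Γ.dist_comm (u := b) (v := a), Γ.dist_comm (u := c) (v := a)]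
    omega
  have a1 := count_add_le hA huv h1
  have a2 := count_add_le hA huv h2
  have a3 := count_add_le hA huv h3
  have a4 := count_add_le hA huv (swap h1)
  have a5 := count_add_le hA huv (swap h2)
  have a6 := count_add_le hA huv (swap h3)
  have b1 := count_le_add hA huv h1
  have b2 := count_le_add hA huv h2
  have b3 := count_le_add hA huv h3
  have b4 := count_le_add hA huv (swap h1)
  have b5 := count_le_add hA huv (swap h2)
  have b6 := count_le_add hA huv (swap h3)
  simp only [signedCount]
  rw [abs_le]
  omega

/-- The homogenized counting quasimorphism of a segment. Its value at `g` is the asymptotic count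
along the orbit of any vertex under the powers of `g`. -/
theorem exists_counting_quasimorphism (hA : IsTreeAction G Γ) (huv : 0 < Γ.dist u v) :
    ∃ f : G → ℝ, IsHomogeneousQuasimorphism f 6 ∧ ∀ (g : G) (y : X),
      Tendsto (fun n : ℕ => (signedCount G Γ u v y (g ^ n • y) : ℝ) / n) atTop (𝓝 (f g)) := by
  have htri : ∀ p q r : X, |(signedCount G Γ u v p r : ℝ) - signedCount G Γ u v p q -
      signedCount G Γ u v q r| ≤ 3 := by
    intro p q r
    exact_mod_cast abs_signedCount_triangle_le hA huv p q r
  set h : G → ℝ := fun g => signedCount G Γ u v u (g • u) with hh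
  have hD : ∀ a b, |h (a * b) - h a - h b| ≤ 3 := by
    intro a b
    have := htri u (a • u) ((a * b) • u)
    rw [mul_smul, signedCount_smul hA huv] at this
    simpa [hh, mul_smul] using this
  have hinv : ∀ a, h a⁻¹ = -h a := by
    intro a
    have := signedCount_smul hA huv a u (a⁻¹ • u)
    rw [smul_inv_smul, signedCount_swap] at this
    simp only [hh, ← this]
    push_cast
    rfl
  choose f hf using fun g => exists_tendsto_div hD g
  refine ⟨f, ?_, fun g y => ?_⟩
  · have := isHomogeneousQuasimorphism_of_tendsto hD hinv hf
    norm_num at this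
    exact this
  · -- Moving the base point changes the count by a bounded amount.
    have hbd : ∀ n : ℕ, |(signedCount G Γ u v y (g ^ n • y) : ℝ) - h (g ^ n)| ≤ 6 := by
      intro n
      have h1 := htri y u (g ^ n • y)
      have h2 := htri u (g ^ n • u) (g ^ n • y)
      rw [signedCount_smul hA huv, signedCount_swap y u] at h2
      simp only [hh]
      push_cast at h2
      rw [abs_le] at *
      constructor <;> linarith
    have hz : Tendsto (fun n : ℕ => ((signedCount G Γ u v y (g ^ n • y) : ℝ) - h (g ^ n)) / n) atTop
        (𝓝 0) := by
      refine squeeze_zero_norm (fun n => ?_) (tendsto_const_div_atTop_nhds_zero_nat (6 : ℝ))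
      rw [norm_div, Real.norm_eq_abs, Real.norm_natCast]
      exact div_le_div_of_nonneg_right (hbd n) (Nat.cast_nonneg n)
    have := hz.add (hf g)
    rw [zero_add] at this
    refine this.congr fun n => ?_
    ring

end TreeAction

namespace TreeAction

variable {G : Type*} [Group G] {X : Type*} [MulAction G X] {Γ : SimpleGraph X}

/-! ### Translation lengths and axes -/

variable (Γ) in
/-- The least distance by which `g` moves a vertex. -/
noncomputable def translationLength (g : G) : ℕ := sInf (Set.range fun y => Γ.dist y (g • y))

theorem translationLength_le (g : G) (y : X) : translationLength Γ g ≤ Γ.dist y (g • y) :=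
  Nat.sInf_le ⟨y, rfl⟩

theorem exists_dist_eq_translationLength [Nonempty X] (g : G) :
    ∃ y, Γ.dist y (g • y) = translationLength Γ g :=
  Nat.sInf_mem (Set.range_nonempty fun y => Γ.dist y (g • y))

variable (Γ) in
/-- The vertex `y` lies on an axis of `g`: the geodesics between its successive translates under `g`
fit together to a geodesic line. -/
def IsAxial (g : G) (y : X) : Prop :=
  0 < Γ.dist y (g • y) ∧ ∀ n : ℕ, Γ.dist y (g ^ n • y) = n * Γ.dist y (g • y)

/-- An automorphism without fixed vertex translates along an axis, through every vertex that is
moved as little as possible. -/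
theorem isAxial_of_translationLength_pos (hA : IsTreeAction G Γ) {g : G} {y : X}
    (hy : Γ.dist y (g • y) = translationLength Γ g) (hpos : 0 < translationLength Γ g) :
    IsAxial Γ g y := by
  have hmin : ∀ z, Γ.dist y (g • y) ≤ Γ.dist z (g • z) := fun z => hy ▸ translationLength_le g z
  have e1 : Γ.dist (g • y) (g • g • y) = Γ.dist y (g • y) := hA.dist_smul g _ _
  have htwo : Γ.dist y (g • g • y) = Γ.dist y (g • y) + Γ.dist y (g • y) := by
    obtain ⟨o, h1, h2, h3⟩ := hA.isTree.exists_median y (g • y) (g • g • y)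
    -- `o` and its preimage both lie between `y` and `g • y`, at equal distances from the two ends.
    have e2 : Γ.dist y (g⁻¹ • o) = Γ.dist (g • y) o := by
      rw [← hA.dist_smul g, smul_inv_smul]
    have e3 : Γ.dist (g⁻¹ • o) (g • y) = Γ.dist o (g • g • y) := by
      rw [← hA.dist_smul g, smul_inv_smul]
    have c1 := Γ.dist_comm (u := o) (v := g • y)
    have c2 := Γ.dist_comm (u := o) (v := g⁻¹ • o)
    have h4 := hmin (g⁻¹ • o)
    rw [smul_inv_smul] at h4
    have hk : Γ.dist (g • y) o = 0 ∨ Γ.dist y o = 0 := by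
      rcases le_total (Γ.dist y o) (Γ.dist y (g⁻¹ • o)) with h | h
      · have := hA.isTree.dist_eq_sub_of_mem h1 (by omega) h
        omega
      · have := hA.isTree.dist_eq_sub_of_mem (p := y) (q := g • y) (by omega) h1 h
        omega
    rcases hk with hk | hk
    · omega
    -- Otherwise `g` exchanges `y` and `g • y`.
    exfalso
    have hyy : g • g • y = y := by
      have : Γ.dist o (g • g • y) = 0 := by omega
      have h5 := hA.isTree.eq_of_dist_eq_zero this
      have h6 := hA.isTree.eq_of_dist_eq_zero hk
      rw [← h5, ← h6]
    rcases Nat.lt_or_ge (Γ.dist y (g • y)) 2 with hlt | hge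
    · have hadj : Γ.Adj y (g • y) := SimpleGraph.dist_eq_one_iff_adj.mp (by omega)
      exact hA.no_inversion g hadj rfl hyy
    · obtain ⟨z, hz1, hz2⟩ := hA.isTree.exists_dist_eq (p := y) (q := g • y) (k := 1) (by omega)
      have e4 := hA.dist_smul g y z
      have e5 := hA.dist_smul g z (g • y)
      rw [hyy] at e5
      have c3 := Γ.dist_comm (u := g • z) (v := y)
      have c4 := Γ.dist_comm (u := g • z) (v := g • y)
      have h7 := hmin z
      have := hA.isTree.dist_eq_sub_of_mem (p := y) (q := g • y) (a := z) (b := g • z)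
        (by omega) (by omega) (by omega)
      omega
  refine ⟨by omega, fun n => ?_⟩
  induction n using Nat.twoStepInduction with
  | zero => simp
  | one => simp
  | more n ih1 ih2 =>
    have e2 : Γ.dist (g • y) (g ^ (n + 2) • y) = Γ.dist y (g ^ (n + 1) • y) := by
      rw [pow_succ' g (n + 1), mul_smul, hA.dist_smul]
    have e3 : Γ.dist (g • g • y) (g ^ (n + 2) • y) = Γ.dist y (g ^ n • y) := by
      rw [pow_succ' g (n + 1), mul_smul, hA.dist_smul, pow_succ' g n, mul_smul, hA.dist_smul]
    have e4 : (n + 1) * Γ.dist y (g • y) = n * Γ.dist y (g • y) + Γ.dist y (g • y) := by ring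
    have e5 : (n + 2) * Γ.dist y (g • y) =
      n * Γ.dist y (g • y) + Γ.dist y (g • y) + Γ.dist y (g • y) := by ring
    have := hA.isTree.dist_eq_of_overlap (a := y) (b := g • y) (c := g • g • y)
      (e := g ^ (n + 2) • y) (by omega) (by omega) (by omega)
    omega

theorem IsAxial.conj (hA : IsTreeAction G Γ) {g : G} {y : X} (h : IsAxial Γ g y) (k : G) :
    IsAxial Γ (k * g * k⁻¹) (k • y) := by
  have e : ∀ n : ℕ, Γ.dist (k • y) ((k * g * k⁻¹) ^ n • k • y) = Γ.dist y (g ^ n • y) := by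
    intro n
    rw [conj_pow, mul_smul, inv_smul_smul, mul_smul, hA.dist_smul]
  have e1 := e 1
  rw [pow_one, pow_one] at e1
  exact ⟨e1 ▸ h.1, fun n => by rw [e, e1, h.2]⟩

theorem dist_conj (hA : IsTreeAction G Γ) (g k : G) (y : X) :
    Γ.dist (k • y) ((k * g * k⁻¹) • k • y) = Γ.dist y (g • y) := by
  rw [mul_smul, inv_smul_smul, mul_smul, hA.dist_smul]

theorem dist_inv (hA : IsTreeAction G Γ) (g : G) (N : ℕ) (y : X) :
    Γ.dist (g ^ N • y) (g⁻¹ • g ^ N • y) = Γ.dist y (g • y) := by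
  rw [← hA.dist_smul g, smul_inv_smul, ← mul_smul, ← pow_succ', pow_succ, mul_smul, hA.dist_smul,
    Γ.dist_comm]

theorem IsAxial.inv (hA : IsTreeAction G Γ) {g : G} {y : X} (h : IsAxial Γ g y) (N : ℕ) :
    IsAxial Γ g⁻¹ (g ^ N • y) := by
  have e : ∀ n : ℕ, Γ.dist (g ^ N • y) (g⁻¹ ^ n • g ^ N • y) = Γ.dist y (g ^ n • y) := by
    intro n
    rw [← hA.dist_smul (g ^ n), inv_pow, smul_inv_smul, ← mul_smul, ← pow_add, add_comm, pow_add,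
      mul_smul, hA.dist_smul, Γ.dist_comm]
  exact ⟨dist_inv hA g N y ▸ h.1, fun n => by rw [e, dist_inv hA, h.2]⟩

variable (G Γ) in
/-- Only the identity fixes an edge and a different translate of it. -/
def HasTrivialPairStabilizers : Prop :=
  ∀ {x y : X}, Γ.Adj x y → ∀ h k : G, k • x = x → k • y = y → k • h • x = h • x →
    k • h • y = h • y → (h • x = x ∧ h • y = y) ∨ k = 1

/-- If the axis of `w` runs along three periods of the axis of `g`, in the same direction, and `w`
has at most the translation length of `g`, then `g` and `w` commute: their commutator fixes a
segment longer than one period of `g` pointwise, hence an edge and its translate by `g`. If the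
translation lengths are equal, the same holds for `w⁻¹ * g`. -/
theorem commute_of_overlap (hA : IsTreeAction G Γ) (hM : HasTrivialPairStabilizers G Γ) {g w : G}
    {x y : X} (hx : IsAxial Γ g x) (hy : IsAxial Γ w y)
    (hle : Γ.dist y (w • y) ≤ Γ.dist x (g • x)) {N : ℕ}
    (h : Γ.dist y x + Γ.dist x (g ^ 3 • x) + Γ.dist (g ^ 3 • x) (w ^ N • y) =
      Γ.dist y (w ^ N • y)) :
    (Commute g w ∧ Γ.dist x ((w⁻¹ * g) • x) + Γ.dist y (w • y) = Γ.dist x (g • x)) ∧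
      (Γ.dist y (w • y) = Γ.dist x (g • x) → g = w) := by
  have T := hA.isTree
  have tri := fun a b c : X => T.connected.dist_triangle (u := a) (v := b) (w := c)
  set m := Γ.dist y (w • y) with hm
  set l := Γ.dist x (g • x) with hl
  have x3 := hx.2 3
  have x2 := hx.2 2
  have x1 := hx.2 1
  have yN := hy.2 N
  have yN1 := hy.2 (N + 1)
  have e0 : (N + 1) * m = N * m + m := by ring
  rw [← hl] at x3 x2 x1
  rw [← hm] at yN yN1
  rw [pow_one] at x1
  have lpos : 0 < l := hx.1
  have mpos : 0 < m := hy.1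
  have e23 : g ^ 3 • x = g • g ^ 2 • x := by rw [← mul_smul, ← pow_succ']
  have eN : w ^ (N + 1) • y = w • w ^ N • y := by rw [← mul_smul, ← pow_succ']
  -- The action of `w` on the initial part of its axis.
  have hW : ∀ z, Γ.dist y z + Γ.dist z (w ^ N • y) = N * m →
      Γ.dist y (w • z) = Γ.dist y z + m ∧
        Γ.dist y (w • z) + Γ.dist (w • z) (w ^ (N + 1) • y) = Γ.dist y (w ^ (N + 1) • y) := by
    intro z hz
    have h1 := hA.dist_smul w y z
    have h2 := hA.dist_smul w z (w ^ N • y)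
    rw [← eN] at h2
    have h3 := tri y (w • y) (w • z)
    have h4 := tri y (w • z) (w ^ (N + 1) • y)
    omega
  have hOn : ∀ z, Γ.dist y z + Γ.dist z (w ^ N • y) = N * m →
      Γ.dist y z + Γ.dist z (w ^ (N + 1) • y) = Γ.dist y (w ^ (N + 1) • y) := by
    intro z hz
    have h1 := tri z (w ^ N • y) (w ^ (N + 1) • y)
    have h2 := tri y z (w ^ (N + 1) • y)
    have h3 : Γ.dist (w ^ N • y) (w ^ (N + 1) • y) = m := by
      rw [pow_succ, mul_smul, hA.dist_smul]
    omega
  -- The action of `g` on the first two periods of its axis.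
  have hX : ∀ z, Γ.dist x z + Γ.dist z (g ^ 3 • x) = 3 * l → Γ.dist x z ≤ 2 * l →
      Γ.dist x (g • z) = Γ.dist x z + l ∧
        Γ.dist x (g • z) + Γ.dist (g • z) (g ^ 3 • x) = 3 * l := by
    intro z hz hz2
    have h1 : Γ.dist (g ^ 2 • x) (g ^ 3 • x) = l := by
      rw [pow_succ g 2, mul_smul, hA.dist_smul]
    have h2 := T.dist_eq_sub_of_mem (p := x) (q := g ^ 3 • x) (a := z) (b := g ^ 2 • x)
      (by omega) (by omega) (by omega)
    have h3 := hA.dist_smul g z (g ^ 2 • x)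
    rw [← e23] at h3
    have h4 := hA.dist_smul g x z
    have h5 := tri x (g • x) (g • z)
    have h6 := tri x (g • z) (g ^ 3 • x)
    omega
  have hY : ∀ z, Γ.dist x z + Γ.dist z (g ^ 3 • x) = 3 * l →
      Γ.dist y z = Γ.dist y x + Γ.dist x z ∧ Γ.dist y z + Γ.dist z (w ^ N • y) = N * m := by
    intro z hz
    have h1 := tri y x z
    have h2 := tri y z (w ^ N • y)
    have h3 := tri z (g ^ 3 • x) (w ^ N • y)
    omega
  have huniq : ∀ z z', Γ.dist y z + Γ.dist z (w ^ (N + 1) • y) = Γ.dist y (w ^ (N + 1) • y) →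
      Γ.dist y z' + Γ.dist z' (w ^ (N + 1) • y) = Γ.dist y (w ^ (N + 1) • y) →
      Γ.dist y z = Γ.dist y z' → z = z' := by
    intro z z' hz hz' he
    have := T.dist_eq_sub_of_mem hz hz' he.le
    exact T.eq_of_dist_eq_zero (by omega)
  have hxx : Γ.dist x x + Γ.dist x (g ^ 3 • x) = 3 * l := by rw [SimpleGraph.dist_self]; omega
  have hx3 : Γ.dist x (g ^ 3 • x) + Γ.dist (g ^ 3 • x) (g ^ 3 • x) = 3 * l := by
    rw [SimpleGraph.dist_self]; omega
  have hwz : ∀ z, Γ.dist x z + Γ.dist z (g ^ 3 • x) = 3 * l → Γ.dist x z ≤ 2 * l →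
      Γ.dist x (w • z) = Γ.dist x z + m ∧
        Γ.dist x (w • z) + Γ.dist (w • z) (g ^ 3 • x) = 3 * l := by
    intro z hz hz2
    obtain ⟨h1, h2⟩ := hY z hz
    obtain ⟨h3, h4⟩ := hW z h2
    obtain ⟨h5, h6⟩ := hY x hxx
    obtain ⟨h7, h8⟩ := hY _ hx3
    have h9 := T.dist_eq_sub_of_mem (hOn x h6) h4 (by omega)
    have h10 := T.dist_eq_sub_of_mem h4 (hOn _ h8) (by omega)
    omega
  have hcomm : ∀ z, Γ.dist x z + Γ.dist z (g ^ 3 • x) = 3 * l → Γ.dist x z + m ≤ 2 * l →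
      g • w • z = w • g • z := by
    intro z hz hz2
    obtain ⟨h1, h2⟩ := hwz z hz (by omega)
    obtain ⟨h3, h4⟩ := hX _ h2 (by omega)
    obtain ⟨h5, h6⟩ := hY _ h4
    obtain ⟨h7, h8⟩ := hX z hz (by omega)
    obtain ⟨h9, h10⟩ := hY _ h8
    obtain ⟨h11, h12⟩ := hW _ h10
    exact huniq _ _ (hOn _ h6) h12 (by omega)
  have heqz : m = l → ∀ z, Γ.dist x z + Γ.dist z (g ^ 3 • x) = 3 * l → Γ.dist x z ≤ 2 * l →
      g • z = w • z := by
    intro hml z hz hz2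
    obtain ⟨h1, h2⟩ := hwz z hz hz2
    obtain ⟨h3, h4⟩ := hX z hz hz2
    obtain ⟨h5, h6⟩ := hY _ h2
    obtain ⟨h7, h8⟩ := hY _ h4
    exact huniq _ _ (hOn _ h8) (hOn _ h6) (by omega)
  -- The first edge of the axis and its translate by `g`.
  obtain ⟨z, hz1, hz2⟩ := T.exists_dist_eq (p := x) (q := g ^ 3 • x) (k := 1) (by omega)
  have hadj : Γ.Adj x z := SimpleGraph.dist_eq_one_iff_adj.mp hz1
  obtain ⟨gx1, gx2⟩ := hX x hxx (by rw [SimpleGraph.dist_self]; omega)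
  obtain ⟨gz1, gz2⟩ := hX z (by omega) (by omega)
  have hgx : g • x ≠ x := by
    intro hgx
    rw [hgx, SimpleGraph.dist_self] at hl
    omega
  have key : ∀ k : G, k • x = x → k • z = z → k • g • x = g • x → k • g • z = g • z → k = 1 :=
    fun k k1 k2 k3 k4 => (hM hadj g k k1 k2 k3 k4).resolve_left fun h => hgx h.1
  have d0 : Γ.dist x x = 0 := SimpleGraph.dist_self
  have heq : m = l → g = w := by
    intro hml
    have hfix : ∀ a : X, g • a = w • a → (w⁻¹ * g) • a = a := by
      intro a ha
      rw [mul_smul, ha, inv_smul_smul]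
    have := key (w⁻¹ * g) (hfix _ (heqz hml _ hxx (by omega)))
      (hfix _ (heqz hml _ (by omega) (by omega))) (hfix _ (heqz hml _ gx2 (by omega)))
      (hfix _ (heqz hml _ gz2 (by omega)))
    rw [inv_mul_eq_one] at this
    exact this.symm
  refine ⟨⟨?_, ?_⟩, heq⟩
  · rcases hle.eq_or_lt with hml | hml
    · rw [heq hml]
    · have hfix : ∀ a : X, g • w • a = w • g • a → ((w * g)⁻¹ * (g * w)) • a = a := by
        intro a ha
        rw [mul_smul, mul_smul g w, ha, ← mul_smul w g, inv_smul_smul]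
      have := key ((w * g)⁻¹ * (g * w)) (hfix _ (hcomm _ hxx (by omega)))
        (hfix _ (hcomm _ (by omega) (by omega))) (hfix _ (hcomm _ gx2 (by omega)))
        (hfix _ (hcomm _ gz2 (by omega)))
      rw [inv_mul_eq_one] at this
      exact this.symm
  · have e1 : Γ.dist x ((w⁻¹ * g) • x) = Γ.dist (w • x) (g • x) := by
      rw [← hA.dist_smul w, mul_smul, smul_inv_smul]
    obtain ⟨h1, h2⟩ := hwz x hxx (by omega)
    have := T.dist_eq_sub_of_mem (p := x) (q := g ^ 3 • x) (a := w • x) (b := g • x)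
      (by omega) (by omega) (by omega)
    omega

end TreeAction

/-! ### Equivalence of chains -/

namespace StableCommutatorLength

variable {G : Type*}

namespace IntegralChain

theorem toReal_add (c c' : IntegralChain G) : (c + c').toReal = c.toReal + c'.toReal :=
  Finsupp.mapRange_add (by simp) _ _

theorem toReal_sub (c c' : IntegralChain G) : (c - c').toReal = c.toReal - c'.toReal :=
  Finsupp.mapRange_sub (by simp) _ _

theorem toReal_single (g : G) (n : ℤ) :
    toReal (Finsupp.single g n) = (n : ℝ) • Finsupp.single g 1 := by
  simp [toReal]

end IntegralChain

variable [Group G]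

theorem Equivalent.refl (c : RealChain G) : Equivalent c c := by
  simp [Equivalent]

theorem Equivalent.trans {a b c : RealChain G} (h : Equivalent a b) (h' : Equivalent b c) :
    Equivalent a c := by
  have := add_mem h h'
  rwa [sub_add_sub_cancel] at this

theorem equivalent_conj (g h : G) :
    Equivalent (Finsupp.single (h * g * h⁻¹) (1 : ℝ)) (Finsupp.single g 1) :=
  Submodule.subset_span (Or.inl (Or.inr ⟨g, h, rfl⟩))

theorem equivalent_zpow (g : G) (n : ℤ) :
    Equivalent (Finsupp.single (g ^ n) (1 : ℝ)) ((n : ℝ) • Finsupp.single g 1) :=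
  Submodule.subset_span (Or.inl (Or.inl ⟨g, n, rfl⟩))

theorem equivalent_mul {g h : G} (hgh : Commute g h) :
    Equivalent (Finsupp.single (g * h) (1 : ℝ)) (Finsupp.single g 1 + Finsupp.single h 1) := by
  rw [Equivalent, ← sub_sub]
  exact Submodule.subset_span (Or.inr ⟨g, h, hgh, rfl⟩)

theorem equivalent_inv (g : G) :
    Equivalent (Finsupp.single g⁻¹ (1 : ℝ)) (-Finsupp.single g 1) := by
  simpa using equivalent_zpow g (-1)

/-- An element conjugate to its inverse is equivalent to the zero chain, because twice it is. -/
theorem single_mem_equivSubspace_of_conj_eq_inv {g k : G} (h : k * g * k⁻¹ = g⁻¹) :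
    (Finsupp.single g 1 : RealChain G) ∈ equivSubspace G := by
  have h1 := equivalent_conj g k
  rw [h] at h1
  have h2 := sub_mem (equivalent_inv g) h1
  have h3 := Submodule.smul_mem (equivSubspace G) (1 / 2 : ℝ) h2
  convert h3 using 1
  module

/-- The terms of a chain may be replaced by conjugates. -/
theorem exists_equivalent_of_forall_conj {P : G → Prop} (c : IntegralChain G)
    (h : ∀ g ∈ c.support, ∃ k, P (k * g * k⁻¹)) :
    ∃ c' : IntegralChain G, (∀ g ∈ c'.support, P g) ∧ Equivalent c.toReal c'.toReal := by
  classical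
  induction c using Finsupp.induction with
  | zero => exact ⟨0, by simp, Equivalent.refl _⟩
  | single_add g n c hg hn ih =>
    rw [Finsupp.support_single_add hg hn] at h
    obtain ⟨c', h1, h2⟩ := ih fun a ha => h a (by simp [ha])
    obtain ⟨k, hk⟩ := h g (by simp)
    refine ⟨Finsupp.single (k * g * k⁻¹) n + c', fun a ha => ?_, ?_⟩
    · rcases Finset.mem_union.mp (Finsupp.support_add ha) with ha | ha
      · rw [Finset.mem_singleton.mp (Finsupp.support_single_subset ha)]
        exact hk
      · exact h1 a ha
    · rw [IntegralChain.toReal_add, IntegralChain.toReal_add, IntegralChain.toReal_single,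
        IntegralChain.toReal_single]
      have h3 := sub_mem h2 (Submodule.smul_mem _ (n : ℝ) (equivalent_conj g k))
      rw [Equivalent]
      convert h3 using 1
      module

/-- Euclid's algorithm on a chain: if a conjugate of a term `g` commutes with `s = w ^ ± 1` for
another term `w`, then `g` can be traded for `w` and the quotient of that conjugate by `s`. -/
theorem exists_equivalent_sum_lt_of_commute (ℓ : G → ℕ) (c : IntegralChain G) {g w s k : G}
    (hg : g ∈ c.support) (hw : w ∈ c.support) (hwg : w ≠ g) (hs : s = w ∨ s = w⁻¹)
    (hcomm : Commute (k * g * k⁻¹) s) (hlt : ℓ (s⁻¹ * (k * g * k⁻¹)) < ℓ g) :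
    ∃ c' : IntegralChain G, Equivalent c.toReal c'.toReal ∧
      ∑ a ∈ c'.support, ℓ a < ∑ a ∈ c.support, ℓ a := by
  classical
  obtain ⟨ε, hε⟩ : ∃ ε : ℤ,
      Equivalent (Finsupp.single s (1 : ℝ)) ((ε : ℝ) • Finsupp.single w 1) := by
    rcases hs with rfl | rfl
    · exact ⟨1, by simpa using Equivalent.refl _⟩
    · exact ⟨-1, by simpa using equivalent_inv w⟩
  set t := s⁻¹ * (k * g * k⁻¹) with ht
  have h1 := equivalent_mul (g := s) (h := t) ((Commute.refl s).inv_right.mul_right hcomm.symm)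
  rw [ht, mul_inv_cancel_left, ← ht] at h1
  set n := c g with hn
  refine ⟨c - Finsupp.single g n + Finsupp.single w (n * ε) + Finsupp.single t n, ?_, ?_⟩
  · simp only [IntegralChain.toReal_add, IntegralChain.toReal_sub, IntegralChain.toReal_single]
    have h2 := Submodule.smul_mem (equivSubspace G) (n : ℝ)
      (add_mem (sub_mem h1 (equivalent_conj g k)) hε)
    rw [Equivalent]
    convert h2 using 1
    push_cast
    module
  · have hsub : (c - Finsupp.single g n + Finsupp.single w (n * ε) + Finsupp.single t n).support ⊆
        insert t (c.support.erase g) := by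
      intro a ha
      rw [Finset.mem_insert, Finset.mem_erase]
      by_contra hcon
      push Not at hcon
      obtain ⟨hat, hac⟩ := hcon
      rw [Finsupp.mem_support_iff] at ha
      apply ha
      by_cases hag : a = g
      · subst hag
        simp [hn, hwg, hat.symm]
      · have hac' := hac hag
        have haw : w ≠ a := fun h => hac' (h ▸ hw)
        rw [Finsupp.notMem_support_iff] at hac'
        simp [hac', haw, hat.symm, Ne.symm hag]
    calc _ ≤ ∑ a ∈ insert t (c.support.erase g), ℓ a := Finset.sum_le_sum_of_subset hsub
      _ ≤ ℓ t + ∑ a ∈ c.support.erase g, ℓ a := by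
          by_cases htm : t ∈ c.support.erase g
          · rw [Finset.insert_eq_of_mem htm]; exact Nat.le_add_left _ _
          · rw [Finset.sum_insert htm]
      _ < ℓ g + ∑ a ∈ c.support.erase g, ℓ a := by omega
      _ = _ := Finset.add_sum_erase _ _ hg

theorem exists_equivalent_sum_lt_of_conj_eq_inv (ℓ : G → ℕ) (c : IntegralChain G) {g k : G}
    (hg : g ∈ c.support) (h : k * g * k⁻¹ = g⁻¹) (hpos : 0 < ℓ g) :
    ∃ c' : IntegralChain G, Equivalent c.toReal c'.toReal ∧
      ∑ a ∈ c'.support, ℓ a < ∑ a ∈ c.support, ℓ a := by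
  classical
  refine ⟨c.erase g, ?_, ?_⟩
  · have h1 : c.erase g = c - Finsupp.single g (c g) := by
      rw [eq_sub_iff_add_eq, Finsupp.erase_add_single]
    rw [h1, IntegralChain.toReal_sub, IntegralChain.toReal_single, Equivalent, sub_sub_cancel]
    exact Submodule.smul_mem _ _ (single_mem_equivSubspace_of_conj_eq_inv h)
  · rw [Finsupp.support_erase, ← Finset.add_sum_erase _ _ hg]
    omega

end StableCommutatorLength

/-! ### The gap for chains under an action on a tree -/

namespace TreeAction

variable {G : Type*} [Group G] {X : Type*} [MulAction G X] {Γ : SimpleGraph X}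

theorem exists_smul_eq_of_translationLength_eq_zero [Nonempty X] (hA : IsTreeAction G Γ) {g : G}
    (h : translationLength Γ g = 0) : ∃ y : X, g • y = y := by
  obtain ⟨y, hy⟩ := exists_dist_eq_translationLength (Γ := Γ) g
  exact ⟨y, (hA.isTree.eq_of_dist_eq_zero (hy.trans h)).symm⟩

/-- The dichotomy for a single chain with a term `g` of greatest translation length: either some
other axis runs along three periods of the axis of `g`, and the chain can be simplified, or the
counting quasimorphism of three periods of the axis of `g` takes the value `1 / 3` at `g` and
vanishes at all other terms. -/
theorem exists_simpler_or_exists_quasimorphism [Nonempty X] (hA : IsTreeAction G Γ)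
    (hM : HasTrivialPairStabilizers G Γ) (c : IntegralChain G) {g : G} (hg : g ∈ c.support)
    (hpos : 0 < translationLength Γ g)
    (hmax : ∀ w ∈ c.support, translationLength Γ w ≤ translationLength Γ g) :
    (∃ c' : IntegralChain G, Equivalent c.toReal c'.toReal ∧
      ∑ a ∈ c'.support, translationLength Γ a < ∑ a ∈ c.support, translationLength Γ a) ∨
    ∃ f : G → ℝ, IsHomogeneousQuasimorphism f 6 ∧ 1 / 3 ≤ |c.sum fun a n => n * f a| := by
  rw [or_iff_not_imp_left]
  intro hno
  have hlt : ∀ {w s k : G}, w ∈ c.support → w ≠ g → s = w ∨ s = w⁻¹ → Commute (k * g * k⁻¹) s →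
      ¬ translationLength Γ (s⁻¹ * (k * g * k⁻¹)) < translationLength Γ g :=
    fun hw hwg hs hcomm hlt => hno
      (exists_equivalent_sum_lt_of_commute (translationLength Γ) c hg hw hwg hs hcomm hlt)
  have hinv : ∀ k : G, k * g * k⁻¹ ≠ g⁻¹ := fun k hk => hno
    (exists_equivalent_sum_lt_of_conj_eq_inv (translationLength Γ) c hg hk hpos)
  obtain ⟨x, hx⟩ := exists_dist_eq_translationLength (Γ := Γ) g
  have hax := isAxial_of_translationLength_pos hA hx hpos
  have x3 := hax.2 3
  have huv : 0 < Γ.dist x (g ^ 3 • x) := by rw [x3, hx]; omega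
  obtain ⟨f, hf, hlim⟩ := exists_counting_quasimorphism (G := G) hA huv
  -- A copy of the segment gives a commuting conjugate of `g`.
  have hcopy : ∀ {s : G} {y : X} {N : ℕ} {k : G}, IsAxial Γ s y →
      Γ.dist y (s • y) ≤ Γ.dist x (g • x) →
      Γ.dist y (k • x) + Γ.dist x (g ^ 3 • x) + Γ.dist (k • g ^ 3 • x) (s ^ N • y) =
        Γ.dist y (s ^ N • y) →
      (Commute (k * g * k⁻¹) s ∧
        Γ.dist (k • x) ((s⁻¹ * (k * g * k⁻¹)) • k • x) + Γ.dist y (s • y) = Γ.dist x (g • x)) ∧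
      (Γ.dist y (s • y) = Γ.dist x (g • x) → k * g * k⁻¹ = s) := by
    intro s y N k hy hle h
    have e3 : (k * g * k⁻¹) ^ 3 • k • x = k • g ^ 3 • x := by
      rw [conj_pow, mul_smul, inv_smul_smul, mul_smul]
    have := commute_of_overlap hA hM (hax.conj hA k) hy (by rwa [dist_conj hA]) (N := N)
      (by rw [e3, hA.dist_smul]; exact h)
    rwa [dist_conj hA] at this
  have hnone : ∀ {w s : G} {y : X} {N : ℕ} {k : G}, w ∈ c.support → w ≠ g → s = w ∨ s = w⁻¹ →
      IsAxial Γ s y → Γ.dist y (s • y) ≤ Γ.dist x (g • x) →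
      Γ.dist y (k • x) + Γ.dist x (g ^ 3 • x) + Γ.dist (k • g ^ 3 • x) (s ^ N • y) ≠
        Γ.dist y (s ^ N • y) := by
    intro w s y N k hw hwg hs hy hle h
    obtain ⟨⟨h1, h2⟩, -⟩ := hcopy hy hle h
    refine hlt hw hwg hs h1 ?_
    have h3 := translationLength_le (Γ := Γ) (s⁻¹ * (k * g * k⁻¹)) (k • x)
    have h4 := hy.1
    omega
  have hback : ∀ (w : G) (y : X) (N : ℕ), (w⁻¹) ^ N • w ^ N • y = y := by
    intro w y N
    rw [inv_pow, inv_smul_smul]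
  have hother : ∀ w ∈ c.support, w ≠ g → f w = 0 := by
    intro w hw hwg
    obtain ⟨y, hy⟩ := exists_dist_eq_translationLength (Γ := Γ) w
    have hz : ∀ n : ℕ, signedCount G Γ x (g ^ 3 • x) y (w ^ n • y) = 0 := by
      intro n
      rcases Nat.eq_zero_or_pos (translationLength Γ w) with h0 | hpw
      · have hfix : w • y = y := (hA.isTree.eq_of_dist_eq_zero (hy.trans h0)).symm
        have : w ^ n • y = y := by
          induction n with
          | zero => simp
          | succ n ih => rw [pow_succ, mul_smul, hfix, ih]
        rw [this, signedCount, sub_self]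
      · have hwax := isAxial_of_translationLength_pos hA hy hpw
        have hle : Γ.dist y (w • y) ≤ Γ.dist x (g • x) := by
          rw [hy, hx]
          exact hmax w hw
        have h1 : count G Γ x (g ^ 3 • x) y (w ^ n • y) = 0 :=
          count_eq_zero huv fun k => hnone hw hwg (Or.inl rfl) hwax hle
        have h2 : count G Γ x (g ^ 3 • x) (w ^ n • y) y = 0 := by
          refine count_eq_zero huv fun k => ?_
          have := hnone (N := n) (k := k) hw hwg (Or.inr rfl) (hwax.inv hA n)
            (by rwa [dist_inv hA])
          rwa [hback] at this
        rw [signedCount, h1, h2, sub_self]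
    refine tendsto_nhds_unique (hlim w y) ?_
    simp [hz]
  have hfg : f g = 1 / 3 := by
    have hd : ∀ m : ℕ, Γ.dist x ((g ^ 3) ^ m • x) = m * Γ.dist x (g ^ 3 • x) := by
      intro m
      rw [← pow_mul, hax.2, x3]
      ring
    have hcop : ∀ n : ℕ, Copies G Γ x (g ^ 3 • x) n x ((g ^ 3) ^ n • x) := by
      intro n
      induction n with
      | zero => trivial
      | succ n ih =>
        have h3 : Copies G Γ x (g ^ 3 • x) 1 ((g ^ 3) ^ n • x) ((g ^ 3) ^ (n + 1) • x) := by
          refine ⟨(g ^ 3) ^ n, ?_, trivial⟩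
          rw [pow_succ (g ^ 3), mul_smul, SimpleGraph.dist_self, SimpleGraph.dist_self,
            hA.dist_smul]
          omega
        refine ih.append hA ?_ h3
        rw [hd, hd, pow_succ (g ^ 3), mul_smul, hA.dist_smul]
        ring
    have hval : ∀ n : ℕ, signedCount G Γ x (g ^ 3 • x) x ((g ^ 3) ^ n • x) = n := by
      intro n
      have h1 : count G Γ x (g ^ 3 • x) ((g ^ 3) ^ n • x) x = 0 := by
        refine count_eq_zero huv fun k h => hinv k ?_
        rw [← pow_mul] at h
        refine (hcopy (N := 3 * n) (k := k) (hax.inv hA (3 * n)) (dist_inv hA g _ x).le ?_).2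
          (dist_inv hA g _ x)
        rwa [hback]
      have h2 : count G Γ x (g ^ 3 • x) x ((g ^ 3) ^ n • x) = n := by
        refine le_antisymm ?_ (Copies.le_count huv ?_)
        · have := (copies_count (G := G) huv x ((g ^ 3) ^ n • x)).mul_dist_le
          rw [hd] at this
          exact Nat.le_of_mul_le_mul_right this huv
        · exact hcop n
      rw [signedCount, h1, h2]
      simp
    have h3 : f (g ^ 3) = 1 := by
      refine tendsto_nhds_unique (hlim (g ^ 3) x) ?_
      refine tendsto_const_nhds.congr' ?_
      filter_upwards [eventually_gt_atTop 0] with n hn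
      rw [hval]
      have : (n : ℝ) ≠ 0 := by positivity
      push_cast
      rw [div_self this]
    rw [hf.map_pow] at h3
    push_cast at h3
    linarith
  refine ⟨f, hf, ?_⟩
  rw [Finsupp.sum, Finset.sum_eq_single_of_mem g hg fun w hw hwg => by
    rw [hother w hw hwg, mul_zero], hfg, abs_mul]
  have h1 : (1 : ℝ) ≤ |(c g : ℝ)| := by
    rw [← Int.cast_abs]
    exact_mod_cast Int.one_le_abs (Finsupp.mem_support_iff.mp hg)
  rw [abs_of_pos (by norm_num : (0 : ℝ) < 1 / 3)]
  linarith

/-- Chains without elliptic representative have `scl` at least `1 / 36`. The chain is simplified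
until the total translation length of its terms is minimal. -/
theorem exists_elliptic_or_le_scl [Nonempty X] (hA : IsTreeAction G Γ)
    (hM : HasTrivialPairStabilizers G Γ) (c : IntegralChain G) :
    (∃ c' : IntegralChain G, (∀ g ∈ c'.support, ∃ y : X, g • y = y) ∧
      Equivalent c.toReal c'.toReal) ∨ 1 / 36 ≤ scl c := by
  have main : ∀ (N : ℕ) (c : IntegralChain G), ∑ a ∈ c.support, translationLength Γ a = N →
      (∃ c' : IntegralChain G, (∀ g ∈ c'.support, ∃ y : X, g • y = y) ∧
        Equivalent c.toReal c'.toReal) ∨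
      ∃ f : G → ℝ, IsHomogeneousQuasimorphism f 6 ∧ 1 / 3 ≤ |c.sum fun a n => n * f a| := by
    intro N
    induction N using Nat.strong_induction_on with
    | _ N ih =>
      intro c hc
      by_cases hell : ∀ a ∈ c.support, translationLength Γ a = 0
      · exact Or.inl ⟨c, fun g hg => exists_smul_eq_of_translationLength_eq_zero hA (hell g hg),
          Equivalent.refl _⟩
      push Not at hell
      obtain ⟨b, hb, hb0⟩ := hell
      obtain ⟨g, hg, hmax⟩ := c.support.exists_max_image (translationLength Γ) ⟨b, hb⟩
      have hpos : 0 < translationLength Γ g := (Nat.pos_of_ne_zero hb0).trans_le (hmax b hb)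
      rcases exists_simpler_or_exists_quasimorphism hA hM c hg hpos hmax with ⟨c', he, hlt⟩ | h
      · rcases ih _ (hc ▸ hlt) c' rfl with ⟨c'', h1, h2⟩ | ⟨f, hf, h1⟩
        · exact Or.inl ⟨c'', h1, he.trans h2⟩
        · exact Or.inr ⟨f, hf, by rwa [hf.sum_eq_of_equivalent he]⟩
      · exact Or.inr h
  refine (main _ c rfl).imp id fun ⟨f, hf, h1⟩ => ?_
  refine le_trans ?_ (hf.ofReal_le_scl (by norm_num) c)
  have h2 : (1 / 36 : ENNReal) = ENNReal.ofReal (1 / 36) := by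
    rw [ENNReal.ofReal_div_of_pos (by norm_num)]
    simp
  rw [h2]
  refine ENNReal.ofReal_le_ofReal ?_
  rw [le_div_iff₀ (by norm_num)]
  linarith

end TreeAction

open TreeAction

/-! ### Potentials on trees -/

/-- On a tree, every antisymmetric labelling of the directed edges by group elements is the
coboundary of a function on the vertices: take products along paths from a root. -/
theorem SimpleGraph.IsTree.exists_potential {V A : Type*} [Group A] {Γ : SimpleGraph V}
    (hΓ : Γ.IsTree) (ω : V → V → A) (hω : ∀ u v, Γ.Adj u v → ω v u = (ω u v)⁻¹) :
    ∃ p : V → A, ∀ u v, Γ.Adj u v → p v = p u * ω u v := by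
  obtain ⟨r⟩ := hΓ.connected.nonempty
  choose P hP using fun v => (hΓ.existsUnique_path r v).exists
  let φ : ∀ v, Γ.Walk r v → A := fun v w => (w.darts.map fun d => ω d.fst d.snd).prod
  have hφ : ∀ {u v : V} (w : Γ.Walk r u) (h : Γ.Adj u v),
      φ v (w.concat h) = φ u w * ω u v := by
    intro u v w h
    simp [φ, SimpleGraph.Walk.darts_concat]
  refine ⟨fun v => φ v (P v), fun u v h => ?_⟩
  by_cases hu : u ∈ (P v).support
  · simp only
    rw [hΓ.isAcyclic.path_concat (hP u) (hP v) h hu]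
    exact hφ _ h
  · have hv := hΓ.isAcyclic.mem_support_of_ne_mem_support_of_adj_of_isPath (hP u) (hP v) h hu
    have h1 := hΓ.isAcyclic.path_concat (hP v) (hP u) h.symm hv
    simp only
    rw [h1, hφ, hω u v h, inv_mul_cancel_right]

/-! ### The Bass–Serre tree -/

namespace GraphOfGroups

variable {V : Type u₁} {E : Type u₂} (𝒢 : GraphOfGroups.{u₁, u₂, u₃, u₄} V E) (T : Set E)

/-- The stable letter of an edge, in the fundamental group. -/
def stableLetter (e : E) : 𝒢.FundamentalGroup T :=
  QuotientGroup.mk' (Subgroup.normalClosure (𝒢.relators T)) (𝒢.freeStableLetter e)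

variable {𝒢 T}

theorem stableLetter_conj (e : E) (c : 𝒢.edgeGroup e) :
    𝒢.stableLetter T e * 𝒢.vertexHom T (𝒢.tgt e) (𝒢.tgtHom e c) * (𝒢.stableLetter T e)⁻¹ =
      𝒢.vertexHom T (𝒢.src e) (𝒢.srcHom e c) := by
  rw [← mul_inv_eq_one]
  exact (QuotientGroup.eq_one_iff _).mpr
    (Subgroup.subset_normalClosure (Or.inl ⟨e, c, rfl⟩))

theorem stableLetter_eq_one {e : E} (he : e ∈ T) : 𝒢.stableLetter T e = 1 :=
  (QuotientGroup.eq_one_iff _).mpr (Subgroup.subset_normalClosure (Or.inr ⟨e, he, rfl⟩))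

/-- The vertex groups and the stable letters generate the fundamental group. -/
theorem eq_top_of_vertexHom_mem_of_stableLetter_mem (K : Subgroup (𝒢.FundamentalGroup T))
    (h₁ : ∀ v x, 𝒢.vertexHom T v x ∈ K) (h₂ : ∀ e, 𝒢.stableLetter T e ∈ K) : K = ⊤ := by
  rw [Subgroup.eq_top_iff']
  intro g
  obtain ⟨x, rfl⟩ := QuotientGroup.mk'_surjective _ g
  induction x using Monoid.Coprod.induction_on with
  | inl x =>
    induction x using Monoid.CoprodI.induction_on with
    | one => simp only [map_one]; exact K.one_mem
    | of v x => exact h₁ v x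
    | mul x y hx hy => simp only [map_mul]; exact K.mul_mem hx hy
  | inr x =>
    induction x using FreeGroup.induction_on with
    | C1 => simp only [map_one]; exact K.one_mem
    | of e => exact h₂ e
    | inv_of e he => simp only [map_inv]; exact K.inv_mem he
    | mul x y hx hy => simp only [map_mul]; exact K.mul_mem hx hy
  | mul x y hx hy => simp only [map_mul]; exact K.mul_mem hx hy

/-- The universal property of the fundamental group. -/
theorem exists_lift {N : Type*} [Group N] (φ : ∀ v, 𝒢.vertexGroup v →* N) (τ : E → N)
    (h₁ : ∀ e c, τ e * φ _ (𝒢.tgtHom e c) * (τ e)⁻¹ = φ _ (𝒢.srcHom e c))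
    (h₂ : ∀ e ∈ T, τ e = 1) :
    ∃ D : 𝒢.FundamentalGroup T →* N, (∀ v x, D (𝒢.vertexHom T v x) = φ v x) ∧
      ∀ e, D (𝒢.stableLetter T e) = τ e := by
  let D₀ : 𝒢.FreeProd →* N := Monoid.Coprod.lift (Monoid.CoprodI.lift φ) (FreeGroup.lift τ)
  have hv : ∀ v x, D₀ (𝒢.freeVertexHom v x) = φ v x := by
    intro v x
    simp [D₀, freeVertexHom]
  have ht : ∀ e, D₀ (𝒢.freeStableLetter e) = τ e := by
    intro e
    simp [D₀, freeStableLetter]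
  have hker : Subgroup.normalClosure (𝒢.relators T) ≤ D₀.ker := by
    refine Subgroup.normalClosure_le_normal ?_
    rintro _ (⟨e, c, rfl⟩ | ⟨e, he, rfl⟩)
    · simp only [SetLike.mem_coe, MonoidHom.mem_ker, map_mul, map_inv, hv, ht, h₁, mul_inv_cancel]
    · simp only [SetLike.mem_coe, MonoidHom.mem_ker, ht, h₂ e he]
  exact ⟨QuotientGroup.lift _ D₀ hker, hv, ht⟩

variable (𝒢 T)

/-- The vertices of the Bass–Serre tree: cosets of the (images of the) vertex groups. -/
abbrev TreeVertex : Type _ := Σ v, 𝒢.FundamentalGroup T ⧸ 𝒢.vertexSubgroup T v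

/-- The edges of the Bass–Serre tree: cosets of the (images of the) edge groups. -/
abbrev TreeEdge : Type _ := Σ e, 𝒢.FundamentalGroup T ⧸ 𝒢.edgeSubgroup T e

variable {𝒢 T}

/-- The terminus of the edge `g C` is `g G_v`, as `C` is embedded in the vertex group at the
terminus. -/
def terminus (q : 𝒢.TreeEdge T) : 𝒢.TreeVertex T :=
  ⟨𝒢.tgt q.1, Quotient.map' id (by
    intro a b h
    rw [QuotientGroup.leftRel_apply] at h ⊢
    obtain ⟨c, hc⟩ := h
    exact ⟨𝒢.tgtHom q.1 c, hc⟩) q.2⟩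

/-- The origin of the edge `g C` is `g t⁻¹ G_v`, where `t` is the stable letter, which conjugates
`C` into the vertex group at the origin. -/
def origin (q : 𝒢.TreeEdge T) : 𝒢.TreeVertex T :=
  ⟨𝒢.src q.1, Quotient.map' (fun g => g * (𝒢.stableLetter T q.1)⁻¹) (by
    intro a b h
    rw [QuotientGroup.leftRel_apply] at h ⊢
    obtain ⟨c, hc⟩ := h
    refine ⟨𝒢.srcHom q.1 c, ?_⟩
    rw [← stableLetter_conj, mul_inv_rev, inv_inv]
    have hc' : 𝒢.vertexHom T (𝒢.tgt q.1) (𝒢.tgtHom q.1 c) = a⁻¹ * b := hc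
    rw [hc']
    simp only [mul_assoc]) q.2⟩

theorem terminus_mk (e : E) (g : 𝒢.FundamentalGroup T) :
    terminus (⟨e, (g : 𝒢.FundamentalGroup T ⧸ 𝒢.edgeSubgroup T e)⟩ : 𝒢.TreeEdge T) =
      ⟨𝒢.tgt e, (g : 𝒢.FundamentalGroup T ⧸ 𝒢.vertexSubgroup T (𝒢.tgt e))⟩ := rfl

theorem origin_mk (e : E) (g : 𝒢.FundamentalGroup T) :
    origin (⟨e, (g : 𝒢.FundamentalGroup T ⧸ 𝒢.edgeSubgroup T e)⟩ : 𝒢.TreeEdge T) =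
      ⟨𝒢.src e, ((g * (𝒢.stableLetter T e)⁻¹ : 𝒢.FundamentalGroup T) :
        𝒢.FundamentalGroup T ⧸ 𝒢.vertexSubgroup T (𝒢.src e))⟩ := rfl

theorem terminus_smul (g : 𝒢.FundamentalGroup T) (q : 𝒢.TreeEdge T) :
    terminus (g • q) = g • terminus q := by
  obtain ⟨e, q⟩ := q
  induction q using QuotientGroup.induction_on with
  | H a => rfl

theorem origin_smul (g : 𝒢.FundamentalGroup T) (q : 𝒢.TreeEdge T) :
    origin (g • q) = g • origin q := by
  obtain ⟨e, q⟩ := q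
  induction q using QuotientGroup.induction_on with
  | H a =>
    rw [origin_mk, Sigma.smul_mk, Sigma.smul_mk, MulAction.Quotient.smul_coe,
      MulAction.Quotient.smul_coe, origin_mk, smul_eq_mul, smul_eq_mul, mul_assoc]

/-- A crossed homomorphism on the fundamental group with prescribed values, in the form of the
functions `F v g = δ g * g • p v` it gives on the translates of the vertices `v`. It is a
homomorphism to a semidirect product, obtained from the universal property: an element `x` of the
vertex group at `v` goes to its conjugate by `p v`. -/
theorem exists_crossed {N : Type*} [Group N] (α : 𝒢.FundamentalGroup T →* MulAut N) (p : V → N)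
    (ε : E → N) (hfix : ∀ e c, α (𝒢.vertexHom T _ (𝒢.tgtHom e c)) (ε e) = ε e)
    (hp : ∀ e ∈ T, p (𝒢.tgt e) = p (𝒢.src e) * ε e) :
    ∃ F : V → 𝒢.FundamentalGroup T → N, (∀ v g x, F v (g * 𝒢.vertexHom T v x) = F v g) ∧
      ∀ e g, F (𝒢.tgt e) g = F (𝒢.src e) (g * (𝒢.stableLetter T e)⁻¹) * α g (ε e) := by
  obtain ⟨D, hDv, hDt⟩ := exists_lift (T := T) (N := N ⋊[α] 𝒢.FundamentalGroup T)
    (fun v => ((MulAut.conj (SemidirectProduct.inl (p v))).toMonoidHom.comp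
      SemidirectProduct.inr).comp (𝒢.vertexHom T v))
    (fun e => SemidirectProduct.inl (p (𝒢.src e)) * SemidirectProduct.inr (𝒢.stableLetter T e) *
      SemidirectProduct.inl (ε e) * (SemidirectProduct.inl (p (𝒢.tgt e)))⁻¹)
    (by
      intro e c
      have h := SemidirectProduct.inl_aut (φ := α) (𝒢.vertexHom T _ (𝒢.tgtHom e c)) (ε e)
      rw [hfix, map_inv, eq_mul_inv_iff_mul_eq] at h
      simp only [MonoidHom.comp_apply, MulEquiv.coe_toMonoidHom, MulAut.conj_apply]
      rw [← stableLetter_conj, map_mul, map_mul, map_inv]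
      simp only [mul_inv_rev, inv_inv, mul_assoc, inv_mul_cancel_left]
      rw [← mul_assoc (SemidirectProduct.inl (ε e)) (SemidirectProduct.inr _), h]
      simp only [mul_assoc, mul_inv_cancel_left])
    (by
      intro e he
      rw [stableLetter_eq_one he, hp e he, map_one, mul_one, map_mul, mul_inv_cancel])
  have hright : ∀ g, (D g).right = g := by
    have h := eq_top_of_vertexHom_mem_of_stableLetter_mem
      (MonoidHom.eqLocus (SemidirectProduct.rightHom.comp D) (MonoidHom.id _))
      (fun v x => by
        change SemidirectProduct.rightHom (D _) = _
        rw [hDv]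
        simp)
      (fun e => by
        change SemidirectProduct.rightHom (D _) = _
        rw [hDt]
        simp)
    intro g
    have h' : g ∈ MonoidHom.eqLocus (SemidirectProduct.rightHom.comp D) (MonoidHom.id _) := by
      rw [h]; trivial
    exact h'
  refine ⟨fun v g => (D g * SemidirectProduct.inl (p v)).left, fun v g x => ?_, fun e g => ?_⟩
  · simp only [map_mul, hDv, MonoidHom.comp_apply, MulEquiv.coe_toMonoidHom, MulAut.conj_apply]
    rw [mul_assoc, inv_mul_cancel_right, ← mul_assoc, SemidirectProduct.mul_left _
      (SemidirectProduct.inr _), SemidirectProduct.left_inr, map_one, mul_one]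
  · have h1 : D (g * (𝒢.stableLetter T e)⁻¹) * SemidirectProduct.inl (p (𝒢.src e)) =
        D g * SemidirectProduct.inl (p (𝒢.tgt e)) * SemidirectProduct.inl (ε e)⁻¹ *
          SemidirectProduct.inr (𝒢.stableLetter T e)⁻¹ := by
      rw [map_mul, map_inv, hDt, map_inv, map_inv]
      simp only [mul_inv_rev, inv_inv, mul_assoc, inv_mul_cancel, mul_one]
    simp only
    rw [h1, SemidirectProduct.mul_left _ (SemidirectProduct.inr _), SemidirectProduct.left_inr,
      map_one, mul_one, SemidirectProduct.mul_left _ (SemidirectProduct.inl (ε e)⁻¹),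
      SemidirectProduct.left_inl, SemidirectProduct.mul_right, SemidirectProduct.right_inl, mul_one,
      hright, map_inv, inv_mul_cancel_right]

theorem mulAutArrow_mulSingle {G A : Type*} [Group G] [MulAction G A] [DecidableEq A] (g : G)
    (q : A) (a : Multiplicative ℤ) :
    mulAutArrow g (Pi.mulSingle q a : A → Multiplicative ℤ) = Pi.mulSingle (g • q) a := by
  ext x
  have h1 : mulAutArrow g (Pi.mulSingle q a : A → Multiplicative ℤ) x =
    (Pi.mulSingle q a : A → Multiplicative ℤ) (g⁻¹ • x) := rfl
  simp only [h1, Pi.mulSingle_apply, inv_smul_eq_iff]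

open Classical in
/-- On the vertices of the Bass–Serre graph there is a function with values in the (multiplicatively
written) integer-valued functions on its edges, whose increment along an edge `q` is the indicator
of `q`. Such a function forbids closed paths without backtracking.

The function `p` in the proof gives its values at the vertices of the lifted spanning tree. -/
theorem exists_tree_potential (hT : 𝒢.IsSpanningTree T) :
    ∃ Φ : 𝒢.TreeVertex T → (𝒢.TreeEdge T → Multiplicative ℤ), ∀ q,
      Φ (terminus q) = Φ (origin q) * Pi.mulSingle q (Multiplicative.ofAdd 1) := by
  let N := 𝒢.TreeEdge T → Multiplicative ℤ
  let ε : E → N := fun e =>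
    Pi.mulSingle ⟨e, ((1 : 𝒢.FundamentalGroup T) : 𝒢.FundamentalGroup T ⧸ 𝒢.edgeSubgroup T e)⟩
      (Multiplicative.ofAdd 1)
  obtain ⟨p, hp⟩ : ∃ p : V → N, ∀ e ∈ T, p (𝒢.tgt e) = p (𝒢.src e) * ε e := by
    let ω : V → V → N := fun u v =>
      if h : ∃ e ∈ T, 𝒢.src e = u ∧ 𝒢.tgt e = v then ε h.choose
      else if h : ∃ e ∈ T, 𝒢.src e = v ∧ 𝒢.tgt e = u then (ε h.choose)⁻¹ else 1
    have hω : ∀ e (he : e ∈ T), ω (𝒢.src e) (𝒢.tgt e) = ε e ∧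
        ω (𝒢.tgt e) (𝒢.src e) = (ε e)⁻¹ := by
      intro e he
      have h1 : ∃ e' ∈ T, 𝒢.src e' = 𝒢.src e ∧ 𝒢.tgt e' = 𝒢.tgt e := ⟨e, he, rfl, rfl⟩
      have h2 : ¬ ∃ e' ∈ T, 𝒢.src e' = 𝒢.tgt e ∧ 𝒢.tgt e' = 𝒢.src e := by
        rintro ⟨e', he', hs, ht⟩
        have : e' = e := hT.injOn he' he (by simp only [hs, ht]; exact Sym2.eq_swap)
        subst this
        exact hT.src_ne_tgt e' he' hs
      have h3 : h1.choose = e := by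
        obtain ⟨h4, h5, h6⟩ := h1.choose_spec
        exact hT.injOn h4 he (by simp only [h5, h6])
      simp only [ω, dif_pos h1, dif_neg h2, h3, and_self]
    obtain ⟨p, hp⟩ := hT.isTree.exists_potential ω (by
      intro u v h
      rw [SimpleGraph.fromEdgeSet_adj] at h
      obtain ⟨⟨e, he, hs⟩, -⟩ := h
      obtain ⟨h1, h2⟩ := hω e he
      rcases Sym2.eq_iff.mp hs with ⟨rfl, rfl⟩ | ⟨rfl, rfl⟩
      · rw [h1, h2]
      · rw [h1, h2, inv_inv])
    refine ⟨p, fun e he => ?_⟩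
    rw [hp (𝒢.src e) (𝒢.tgt e), (hω e he).1]
    rw [SimpleGraph.fromEdgeSet_adj]
    exact ⟨⟨e, he, rfl⟩, hT.src_ne_tgt e he⟩
  obtain ⟨F, hF, hF'⟩ := exists_crossed (mulAutArrow (A := 𝒢.TreeEdge T) (M := Multiplicative ℤ))
    p ε (by
      intro e c
      simp only [ε]
      rw [mulAutArrow_mulSingle, Sigma.smul_mk, MulAction.Quotient.smul_coe, smul_eq_mul, mul_one]
      congr 2
      rw [QuotientGroup.eq, mul_one]
      exact Subgroup.inv_mem _ ⟨c, rfl⟩) hp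
  -- The value does not depend on the representative of the coset.
  have hmk : ∀ (v : V) (g : 𝒢.FundamentalGroup T),
      F v (g : 𝒢.FundamentalGroup T ⧸ 𝒢.vertexSubgroup T v).out = F v g := by
    intro v g
    obtain ⟨⟨_, x, rfl⟩, hx⟩ := QuotientGroup.mk_out_eq_mul (𝒢.vertexSubgroup T v) g
    rw [hx, hF]
  refine ⟨fun x => F x.1 x.2.out, ?_⟩
  rintro ⟨e, q⟩
  induction q using QuotientGroup.induction_on with
  | H g =>
    rw [terminus_mk, origin_mk]
    simp only
    rw [hmk, hmk, hF']
    congr 1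
    simp only [ε]
    rw [mulAutArrow_mulSingle, Sigma.smul_mk, MulAction.Quotient.smul_coe, smul_eq_mul, mul_one]

variable (𝒢 T) in
/-- The Bass–Serre tree of a graph of groups. Passing to a simple graph loses nothing: its edges are
determined by their ends. -/
def bassSerreTree : SimpleGraph (𝒢.TreeVertex T) :=
  SimpleGraph.fromRel fun x y => ∃ q : 𝒢.TreeEdge T, origin q = x ∧ terminus q = y

theorem bassSerreTree_adj_iff {x y : 𝒢.TreeVertex T} :
    (𝒢.bassSerreTree T).Adj x y ↔ x ≠ y ∧ ((∃ q, origin q = x ∧ terminus q = y) ∨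
      ∃ q, origin q = y ∧ terminus q = x) := SimpleGraph.fromRel_adj _ _ _

theorem eq_of_origin_eq_of_terminus_eq (hT : 𝒢.IsSpanningTree T) {q q' : 𝒢.TreeEdge T}
    (ho : origin q = origin q') (ht : terminus q = terminus q') : q = q' := by
  classical
  obtain ⟨Φ, hΦ⟩ := exists_tree_potential hT
  have h := hΦ q
  rw [ho, ht, hΦ q', mul_right_inj] at h
  have h1 := congrFun h q
  by_contra hne
  rw [Pi.mulSingle_eq_same, Pi.mulSingle_eq_of_ne hne] at h1
  exact absurd h1 (by decide)

/-- No two edges join the same vertices in opposite directions, and there are no loops (`q = q'`). -/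
theorem not_reversed (hT : 𝒢.IsSpanningTree T) {q q' : 𝒢.TreeEdge T}
    (ho : origin q = terminus q') (ht : terminus q = origin q') : False := by
  classical
  obtain ⟨Φ, hΦ⟩ := exists_tree_potential hT
  have h := hΦ q
  rw [ho, ht, hΦ q', mul_assoc, left_eq_mul] at h
  have h1 := congrFun h q
  rw [Pi.mul_apply, Pi.mulSingle_eq_same, Pi.mulSingle_apply, Pi.one_apply] at h1
  split_ifs at h1
  · exact absurd (show (1 : ℤ) + 1 = 0 from h1) (by decide)
  · exact absurd (show (0 : ℤ) + 1 = 0 from h1) (by decide)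

theorem origin_ne_terminus (hT : 𝒢.IsSpanningTree T) (q : 𝒢.TreeEdge T) :
    origin q ≠ terminus q := fun h => not_reversed hT h h.symm

theorem adj_origin_terminus (hT : 𝒢.IsSpanningTree T) (q : 𝒢.TreeEdge T) :
    (𝒢.bassSerreTree T).Adj (origin q) (terminus q) :=
  bassSerreTree_adj_iff.mpr ⟨origin_ne_terminus hT q, Or.inl ⟨q, rfl, rfl⟩⟩

theorem bassSerreTree_adj_smul (g : 𝒢.FundamentalGroup T) {x y : 𝒢.TreeVertex T}
    (h : (𝒢.bassSerreTree T).Adj x y) : (𝒢.bassSerreTree T).Adj (g • x) (g • y) := by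
  rw [bassSerreTree_adj_iff] at h ⊢
  refine ⟨fun hne => h.1 (smul_left_cancel g hne), h.2.imp ?_ ?_⟩ <;>
  · rintro ⟨q, rfl, rfl⟩
    exact ⟨g • q, origin_smul g q, terminus_smul g q⟩

theorem bassSerreTree_isAcyclic (hT : 𝒢.IsSpanningTree T) : (𝒢.bassSerreTree T).IsAcyclic := by
  classical
  obtain ⟨Φ, hΦ⟩ := exists_tree_potential hT
  have key : ∀ q : 𝒢.TreeEdge T, (𝒢.bassSerreTree T).IsBridge s(origin q, terminus q) := by
    rintro q ⟨w⟩
    -- Away from the edge `q`, the `q`-component of the potential is constant.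
    have hconst : ∀ {x y : 𝒢.TreeVertex T},
        ((𝒢.bassSerreTree T).deleteEdges {s(origin q, terminus q)}).Walk x y → Φ x q = Φ y q := by
      intro x y w
      induction w with
      | nil => rfl
      | cons h _ ih =>
        rw [← ih]
        rw [SimpleGraph.deleteEdges_adj, bassSerreTree_adj_iff, Set.mem_singleton_iff] at h
        obtain ⟨⟨-, ⟨q', rfl, rfl⟩ | ⟨q', rfl, rfl⟩⟩, hne⟩ := h
        · have : q ≠ q' := by rintro rfl; exact hne rfl
          rw [hΦ q', Pi.mul_apply, Pi.mulSingle_eq_of_ne this, mul_one]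
        · have : q ≠ q' := by rintro rfl; exact hne Sym2.eq_swap
          rw [hΦ q', Pi.mul_apply, Pi.mulSingle_eq_of_ne this, mul_one]
    have h := hconst w
    rw [hΦ q, Pi.mul_apply, Pi.mulSingle_eq_same, left_eq_mul] at h
    exact absurd h (by decide)
  rw [SimpleGraph.isAcyclic_iff_forall_adj_isBridge]
  intro x y h
  obtain ⟨-, ⟨q, rfl, rfl⟩ | ⟨q, rfl, rfl⟩⟩ := bassSerreTree_adj_iff.mp h
  · exact key q
  · rw [Sym2.eq_swap]
    exact key q

theorem bassSerreTree_connected (hT : 𝒢.IsSpanningTree T) : (𝒢.bassSerreTree T).Connected := by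
  obtain ⟨v₀⟩ := hT.isTree.connected.nonempty
  let b : V → 𝒢.TreeVertex T := fun v => ⟨v, ((1 : 𝒢.FundamentalGroup T) : _ ⧸ _)⟩
  have hsmul : ∀ (g : 𝒢.FundamentalGroup T) {x y : 𝒢.TreeVertex T},
      (𝒢.bassSerreTree T).Reachable x y → (𝒢.bassSerreTree T).Reachable (g • x) (g • y) :=
    fun g x y h => h.map (⟨fun x => g • x, bassSerreTree_adj_smul g⟩ :
      𝒢.bassSerreTree T →g 𝒢.bassSerreTree T)
  have hb : ∀ u v, (𝒢.bassSerreTree T).Reachable (b u) (b v) := by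
    intro u v
    obtain ⟨w⟩ := hT.isTree.connected.preconnected u v
    induction w with
    | nil => exact SimpleGraph.Reachable.refl _
    | @cons u v _ h _ ih =>
      refine SimpleGraph.Reachable.trans ?_ ih
      rw [SimpleGraph.fromEdgeSet_adj] at h
      obtain ⟨⟨e, he, hs⟩, -⟩ := h
      have h1 := (adj_origin_terminus hT
        ⟨e, ((1 : 𝒢.FundamentalGroup T) : _ ⧸ 𝒢.edgeSubgroup T e)⟩).reachable
      rw [origin_mk, terminus_mk, stableLetter_eq_one he, inv_one, mul_one] at h1
      rcases Sym2.eq_iff.mp hs with ⟨rfl, rfl⟩ | ⟨rfl, rfl⟩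
      · exact h1
      · exact h1.symm
  let K : Subgroup (𝒢.FundamentalGroup T) :=
    { carrier := {g | (𝒢.bassSerreTree T).Reachable (b v₀) (g • b v₀)}
      one_mem' := by
        rw [Set.mem_ofPred_eq, one_smul]
      mul_mem' := by
        intro g h hg hh
        have := SimpleGraph.Reachable.trans hg (hsmul g hh)
        rwa [← mul_smul] at this
      inv_mem' := by
        intro g hg
        have := (hsmul g⁻¹ hg).symm
        rwa [inv_smul_smul] at this }
  have hK : K = ⊤ := by
    refine eq_top_of_vertexHom_mem_of_stableLetter_mem K (fun v x => ?_) fun e => ?_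
    · have h1 : 𝒢.vertexHom T v x • b v = b v := by
        simp only [b]
        rw [Sigma.smul_mk, MulAction.Quotient.smul_coe, smul_eq_mul, mul_one]
        congr 1
        rw [QuotientGroup.eq, mul_one]
        exact Subgroup.inv_mem _ ⟨x, rfl⟩
      have h2 := hsmul (𝒢.vertexHom T v x) (hb v v₀)
      rw [h1] at h2
      exact (hb v₀ v).trans h2
    · have h1 := (adj_origin_terminus hT
        ⟨e, ((𝒢.stableLetter T e : 𝒢.FundamentalGroup T) : _ ⧸ 𝒢.edgeSubgroup T e)⟩).reachable
      rw [origin_mk, terminus_mk, mul_inv_cancel] at h1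
      have h2 := hsmul (𝒢.stableLetter T e) (hb (𝒢.tgt e) v₀)
      have h3 : 𝒢.stableLetter T e • b (𝒢.tgt e) =
          ⟨𝒢.tgt e, ((𝒢.stableLetter T e : 𝒢.FundamentalGroup T) : _ ⧸ _)⟩ := by
        simp only [b]
        rw [Sigma.smul_mk, MulAction.Quotient.smul_coe, smul_eq_mul, mul_one]
      rw [h3] at h2
      exact ((hb v₀ (𝒢.src e)).trans h1).trans h2
  have hall : ∀ x, (𝒢.bassSerreTree T).Reachable (b v₀) x := by
    rintro ⟨v, q⟩
    induction q using QuotientGroup.induction_on with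
    | H g =>
      have h1 : g ∈ K := by rw [hK]; trivial
      have h2 := SimpleGraph.Reachable.trans h1 (hsmul g (hb v₀ v))
      have h3 : g • b v = ⟨v, (g : 𝒢.FundamentalGroup T ⧸ 𝒢.vertexSubgroup T v)⟩ := by
        simp only [b]
        rw [Sigma.smul_mk, MulAction.Quotient.smul_coe, smul_eq_mul, mul_one]
      rwa [h3] at h2
  have : Nonempty (𝒢.TreeVertex T) := ⟨b v₀⟩
  exact SimpleGraph.Connected.mk fun x y => (hall x).symm.trans (hall y)

theorem isTreeAction (hT : 𝒢.IsSpanningTree T) :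
    IsTreeAction (𝒢.FundamentalGroup T) (𝒢.bassSerreTree T) where
  isTree := ⟨bassSerreTree_connected hT, bassSerreTree_isAcyclic hT⟩
  adj_smul g _ _ h := bassSerreTree_adj_smul g h
  no_inversion := by
    rintro g x y h hxy hyx
    obtain ⟨-, ⟨q, rfl, rfl⟩ | ⟨q, rfl, rfl⟩⟩ := bassSerreTree_adj_iff.mp h
    · exact not_reversed hT (q := g • q) (q' := q) (by rw [origin_smul, hxy])
        (by rw [terminus_smul, hyx])
    · exact not_reversed hT (q := g • q) (q' := q) (by rw [origin_smul, hyx])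
        (by rw [terminus_smul, hxy])

/-- Malnormality of the edge groups, read off the Bass–Serre tree. -/
theorem hasTrivialPairStabilizers (hT : 𝒢.IsSpanningTree T)
    (hmal : ∀ e : E, (𝒢.edgeSubgroup T e).IsMalnormal) :
    HasTrivialPairStabilizers (𝒢.FundamentalGroup T) (𝒢.bassSerreTree T) := by
  have hedge : ∀ (q : 𝒢.TreeEdge T) (h k : 𝒢.FundamentalGroup T), k • q = q → k • h • q = h • q →
      h • q = q ∨ k = 1 := by
    rintro ⟨e, q⟩ h k h1 h2
    induction q using QuotientGroup.induction_on with
    | H g =>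
      simp only [Sigma.smul_mk, MulAction.Quotient.smul_coe, smul_eq_mul, Sigma.mk.injEq,
        heq_eq_eq, true_and, QuotientGroup.eq] at h1 h2 ⊢
      rw [or_iff_not_imp_left]
      intro h3
      have h4 := hmal e (g⁻¹ * h⁻¹ * g) (fun h5 => h3 (by simpa [mul_assoc] using h5))
        (g⁻¹ * k * g) (by simpa [mul_assoc] using Subgroup.inv_mem _ h1)
        (by simpa [mul_assoc] using Subgroup.inv_mem _ h2)
      rwa [mul_assoc, inv_mul_eq_one, eq_comm, mul_eq_right] at h4
  intro x y hadj h k hx hy hhx hhy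
  have hq : ∀ q : 𝒢.TreeEdge T, k • origin q = origin q → k • terminus q = terminus q →
      k • h • origin q = h • origin q → k • h • terminus q = h • terminus q →
      (h • origin q = origin q ∧ h • terminus q = terminus q) ∨ k = 1 := by
    intro q h1 h2 h3 h4
    refine (hedge q h k ?_ ?_).imp_left fun h5 => ?_
    · exact eq_of_origin_eq_of_terminus_eq hT (by rwa [origin_smul]) (by rwa [terminus_smul])
    · exact eq_of_origin_eq_of_terminus_eq hT (by simpa only [origin_smul] using h3)
        (by simpa only [terminus_smul] using h4)
    · rw [← origin_smul, ← terminus_smul, h5]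
      exact ⟨rfl, rfl⟩
  obtain ⟨-, ⟨q, rfl, rfl⟩ | ⟨q, rfl, rfl⟩⟩ := bassSerreTree_adj_iff.mp hadj
  · exact hq q hx hy hhx hhy
  · exact (hq q hy hx hhy hhx).imp_left And.symm

theorem exists_conj_mem_vertexSubgroup_of_smul_eq {g : 𝒢.FundamentalGroup T}
    {y : 𝒢.TreeVertex T} (h : g • y = y) :
    ∃ (v : V) (k : 𝒢.FundamentalGroup T), k * g * k⁻¹ ∈ 𝒢.vertexSubgroup T v := by
  obtain ⟨v, q⟩ := y
  induction q using QuotientGroup.induction_on with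
  | H a =>
    simp only [Sigma.smul_mk, MulAction.Quotient.smul_coe, smul_eq_mul, Sigma.mk.injEq,
      heq_eq_eq, true_and, QuotientGroup.eq] at h
    exact ⟨v, a⁻¹, by simpa [mul_assoc] using Subgroup.inv_mem _ h⟩

end GraphOfGroups

theorem mainTheorem5 {V : Type u₁} {E : Type u₂} (𝒢 : GraphOfGroups.{u₁, u₂, u₃, u₄} V E)
    (T : Set E) (hT : 𝒢.IsSpanningTree T)
    (hmal : ∀ e : E, (𝒢.edgeSubgroup T e).IsMalnormal)
    (c : StableCommutatorLength.IntegralChain (𝒢.FundamentalGroup T)) :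
    (∃ c' : StableCommutatorLength.IntegralChain (𝒢.FundamentalGroup T),
      (∀ g ∈ c'.support, ∃ v : V, g ∈ 𝒢.vertexSubgroup T v) ∧
      StableCommutatorLength.Equivalent
        (StableCommutatorLength.IntegralChain.toReal c)
        (StableCommutatorLength.IntegralChain.toReal c')) ∨
    1 / 36 ≤ StableCommutatorLength.scl c := by
  have := (GraphOfGroups.bassSerreTree_connected hT).nonempty
  refine (exists_elliptic_or_le_scl (GraphOfGroups.isTreeAction hT)
    (GraphOfGroups.hasTrivialPairStabilizers hT hmal) c).imp_left ?_
  rintro ⟨c', h1, h2⟩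
  obtain ⟨c'', h3, h4⟩ := exists_equivalent_of_forall_conj
    (P := fun g => ∃ v : V, g ∈ 𝒢.vertexSubgroup T v) c' fun g hg => by
      obtain ⟨y, hy⟩ := h1 g hg
      obtain ⟨v, k, hk⟩ := GraphOfGroups.exists_conj_mem_vertexSubgroup_of_smul_eq hy
      exact ⟨k, v, hk⟩
  exact ⟨c'', h3, h2.trans h4⟩
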